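/- Let $k$ be a field of characteristic zero and let $n\ge 1$. A cubic hypersurface $X=\{F=0\}\subset\mathbb{P}^{2n+1}$ over $k$ is smooth if it has no singular point over an algebraic closure of $k$, and it is rational over $k$ if it is integral and its function field $k(X)$ is isomorphic, as a $k$-algebra, to $k(x_1,\dots,x_{2n})$. **(1)** Let $X=\{F=0\}\subset\mathbb{P}^{2n+1}$ be a smooth cubic hypersurface over $k$. Assume that $X$ contains two skew (that is, disjoint) $n$-planes $H_1,H_2$ that are conjugate over $k$: they are defined over a quadratic extension $L$ of $k$, and $H_2=\sigma(H_1)$, where $\sigma$ is the nontrivial element of $\mathrm{Gal}(L/k)$. Then $X$ is rational over $k$. More precisely, there is an $(n-1)$-plane $\Lambda\subset\mathbb{P}^{2n+1}$ defined over $k$ with $\Lambda\cap(H_1\cup H_2)=\emptyset$. For every such $\Lambda$, a general $(n+1)$-plane $H\supset\Lambda$ defined over $k$ meets $H_1$ in exactly one point $p$ and $H_2$ in exactly one point, namely $\sigma(p)$; these two points are distinct, and the line joining them meets $X$ in exactly one further point $x_H$, different from $p$ and $\sigma(p)$ and defined over $k$. The assignment $H\mapsto x_H$ is a birational map over $k$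 to $X$ from the Grassmannian $\mathbb{G}(1,n+1)$ parametrizing the $(n+1)$-planes containing $\Lambda$. That is, on each standard affine chart $\mathbb{A}^{2n}$ of this Grassmannian it is given by polynomials with coefficients in $k$ that induce an isomorphism from $k(X)$ onto the field of rational functions of the chart. Here the chart attached to a basis $e_1,e_2,e'_1,\dots,e'_n$ of a complement in $k^{2n+2}$ of the vector space $W$ with $\Lambda=\mathbb{P}(W)$ consists of the planes $\mathbb{P}\big(W+\langle e_1+\sum_i t_{1i}e'_i,\; e_2+\sum_i t_{2i}e'_i\rangle\big)$, and "general" means outside the zero set of some nonzero polynomial in the $t_{ji}$. **(2)** In particular, the Fermat cubic $\{x_0^3+\dots+x_{2n+1}^3=0\}\subset\mathbb{P}^{2n+1}$ is rational over every field $k$ of characteristic zero, for every $n\ge1$. -/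

import Mathlib

open MvPolynomial

/-- The projective hypersurface `F = 0` over `k` is smooth: at no geometric point of it do all the
partial derivatives of `F` vanish. -/
def IsSmoothHypersurface {k ι : Type*} [Field k] (F : MvPolynomial ι k) : Prop :=
  ∀ v : ι → AlgebraicClosure k, v ≠ 0 → aeval v F = 0 → ∃ i, aeval v (pderiv i F) ≠ 0

/-- The homogeneous coordinate ring of the projective hypersurface `F = 0`. -/
abbrev HomogCoordRing {k ι : Type*} [Field k] (F : MvPolynomial ι k) : Type _ :=
  MvPolynomial ι k ⧸ Ideal.span {F}

/-- The class of a polynomial in the total fraction ring of the homogeneous coordinate ring. -/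
noncomputable def toFrac {k ι : Type*} [Field k] (F a : MvPolynomial ι k) :
    FractionRing (HomogCoordRing F) :=
  algebraMap (HomogCoordRing F) (FractionRing (HomogCoordRing F)) (Ideal.Quotient.mk _ a)

/-- The function field `k(X)` of the projective hypersurface `X : F = 0`: the fractions `a / b`
of homogeneous elements of the same degree of the homogeneous coordinate ring, where `b` is not a
zero divisor (when `F` is prime, this means that `b` is not divisible by `F`). -/
noncomputable def functionFieldOf {k ι : Type*} [Field k] (F : MvPolynomial ι k) :
    Subalgebra k (FractionRing (HomogCoordRing F)) where
  carrier := {z | ∃ (d : ℕ) (a b : MvPolynomial ι k), a.IsHomogeneous d ∧ b.IsHomogeneous d ∧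
    Ideal.Quotient.mk (Ideal.span {F}) b ∈ nonZeroDivisors (HomogCoordRing F) ∧
    z * toFrac F b = toFrac F a}
  mul_mem' := by
    rintro z w ⟨d, a, b, ha, hb, hb0, hz⟩ ⟨e, a', b', ha', hb', hb0', hw⟩
    refine ⟨d + e, a * a', b * b', ha.mul ha', hb.mul hb', ?_, ?_⟩
    · rw [map_mul]; exact mul_mem hb0 hb0'
    · simp only [toFrac, map_mul] at *
      rw [← hz, ← hw]; ring
  add_mem' := by
    rintro z w ⟨d, a, b, ha, hb, hb0, hz⟩ ⟨e, a', b', ha', hb', hb0', hw⟩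
    refine ⟨d + e, a * b' + b * a', b * b', (ha.mul hb').add (hb.mul ha'), hb.mul hb', ?_, ?_⟩
    · rw [map_mul]; exact mul_mem hb0 hb0'
    · simp only [toFrac, map_mul, map_add] at *
      rw [← hz, ← hw]; ring
  algebraMap_mem' := by
    intro r
    refine ⟨0, C r, 1, isHomogeneous_C _ _, isHomogeneous_one _ _, by simp, ?_⟩
    simp only [toFrac, map_one, mul_one]
    rw [IsScalarTower.algebraMap_apply k (HomogCoordRing F) (FractionRing (HomogCoordRing F))]
    rfl

/-- The projective hypersurface `X : F = 0` is rational of dimension `m` over `k`: it is integral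
and its function field is `k`-isomorphic to `k(x₁, …, x_m)`. -/
def IsRationalHypersurface {k ι : Type*} [Field k] (m : ℕ) (F : MvPolynomial ι k) : Prop :=
  (Ideal.span {F}).IsPrime ∧
    Nonempty (functionFieldOf F ≃ₐ[k] FractionRing (MvPolynomial (Fin m) k))

/-- The rational map `t ↦ [φ_i(t)]_i` from the affine space with coordinates indexed by `τ` is a
birational map over `k` onto the projective hypersurface `X : F = 0`: `X` is integral, the map
lands in `X`, it is dominant, and the pull-back of rational functions `a / b ↦ a(φ) / b(φ)` is an
isomorphism from `k(X)` onto the field of rational functions in the coordinates. -/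
def IsBirationalParametrization {k ι τ : Type*} [Field k] (F : MvPolynomial ι k)
    (φ : ι → MvPolynomial τ k) : Prop :=
  (Ideal.span {F}).IsPrime ∧
  aeval φ F = 0 ∧
  (∀ (d : ℕ) (b : MvPolynomial ι k), b.IsHomogeneous d → b ∉ Ideal.span {F} → aeval φ b ≠ 0) ∧
  ∃ Φ : functionFieldOf F ≃ₐ[k] FractionRing (MvPolynomial τ k),
    ∀ (z : functionFieldOf F) (d : ℕ) (a b : MvPolynomial ι k),
      a.IsHomogeneous d → b.IsHomogeneous d → b ∉ Ideal.span {F} →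
      (z : FractionRing (HomogCoordRing F)) * toFrac F b = toFrac F a →
      Φ z * algebraMap _ _ (aeval φ b) = algebraMap _ _ (aeval φ a)

/-- A vector over `k`, seen over `L`. -/
def extVec {k : Type*} (L : Type*) {ι : Type*} [Field k] [Field L] [Algebra k L] (v : ι → k) :
    ι → L :=
  fun i => algebraMap k L (v i)

/-- The linear subspace over `L` obtained from one over `k` by extension of scalars. -/
def extSpace {k : Type*} (L : Type*) {ι : Type*} [Field k] [Field L] [Algebra k L]
    (W : Submodule k (ι → k)) : Submodule L (ι → L) :=
  Submodule.span L (extVec L '' (W : Set (ι → k)))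

/-- The projective linear space `ℙ(H)`, defined over `L`, lies in the hypersurface `F = 0`
(for infinite `L`, which is the only case used, `L`-points suffice to test this). -/
def ContainedInHypersurface {k L ι : Type*} [Field k] [Field L] [Algebra k L]
    (F : MvPolynomial ι k) (H : Submodule L (ι → L)) : Prop :=
  ∀ v ∈ H, aeval v F = 0

/-- `H₂` is the conjugate of `H₁` by `σ`, acting on coordinates. -/
def IsConjugateBy {k L ι : Type*} [Field k] [Field L] [Algebra k L] (σ : L ≃ₐ[k] L)
    (H₁ H₂ : Submodule L (ι → L)) : Prop :=
  ∀ v : ι → L, v ∈ H₁ ↔ (fun i => σ (v i)) ∈ H₂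

/-- `[p]` and `[q]` are distinct points, and `[x]` is the third point, distinct from both, in which
the line joining them meets the hypersurface `F = 0`. -/
def IsThirdIntersectionPoint {k L ι : Type*} [Field k] [Field L] [Algebra k L]
    (F : MvPolynomial ι k) (p q x : ι → L) : Prop :=
  LinearIndependent L ![p, q] ∧
  x ∈ Submodule.span L {p, q} ∧ x ∉ Submodule.span L {p} ∧ x ∉ Submodule.span L {q} ∧
  ∀ y ∈ Submodule.span L {p, q}, aeval y F = 0 ↔
    y ∈ Submodule.span L {p} ∨ y ∈ Submodule.span L {q} ∨ y ∈ Submodule.span L {x}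

/-- A standard affine chart of the Grassmannian of linear spaces of (vector space) dimension
`dim W + 2` containing `W`, in terms of a basis `e` of a complement of `W`: the point with
coordinates `t` is the space spanned by `W` and the two vectors `e_j + ∑ i, t_{j,i} e'_i`. -/
def chartPlane {k V : Type*} [Field k] [AddCommGroup V] [Module k V] {n : ℕ}
    (W : Submodule k V) (e : Fin 2 ⊕ Fin n → V) (t : Fin 2 × Fin n → k) : Submodule k V :=
  W ⊔ Submodule.span k
    (Set.range fun j : Fin 2 => e (Sum.inl j) + ∑ i : Fin n, t (j, i) • e (Sum.inr i))

/-!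
# Cubic hypersurfaces with two conjugate skew `n`-planes are rational

Write `L = k(δ)` with `δ² = d` and `σ δ = -δ`. Since `L^ι = H₁ ⊕ σ(H₁)`, the subspaces `H₁` and `H₂`
are the eigenspaces for `δ` and `-δ` of an operator `J` over `k` with `J² = d`
(`QuadraticPresentation.exists_operator`). Thus `k^ι` becomes a vector space over `k(√d) = k[J]`,
the lines joining conjugate points `p = J x + δ x` and `σ(p)` are the lines through `x` and `J x`,
and everything can be done with vectors and polynomials over `k`. As `F` vanishes on `H₁`, it factors
on such a line (`QuadraticPresentation.aeval_pencil`):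
`F(a x + b J x) = (a² - d b²) (a F(x) - b F(J x) / d)`.
The third point on the line is therefore `F(J x) x + d F(x) J x`, which is `thirdPoint`. Multiplying
`x` by `a + b√d` multiplies this vector by the square of the norm `a² - d b²`.

Let `pr` be the projection to coordinates modulo `W`. The condition `Λ ∩ H₁ = ∅` says that `pr x` and
`pr (J x)` determine `x`, so over `L` the space `H₁` is a hyperplane in `L^(n+2)`, the kernel of one
functional. Intersecting it with the plane with chart coordinates `t` gives a vector `P(t)` polynomial
in `t`. Conversely the plane attached to a general `x` is `⟨W, x, J x⟩`, and its chart coordinates are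
the ratios of Plücker coordinates `wedgeForm` of `pr x ∧ pr (J x)`. This is
`exists_chart_parametrization`.

Birationality is `isBirationalParametrization_thirdPointPoly`. Substituting in `thirdPoint (P t)` the
coordinates `t` of the plane of a general vector `x` gives, up to a scalar, `F(J x) x + d F(x) J x`,
which is `F(J x) x` modulo `F`. So a form that vanishes on the image is
divisible by `F`, provided that `F` is prime and does not divide `F ∘ J`. Hence the pull-back of
functions is injective, and its image contains the chart coordinates, which are ratios of quadratic
forms on the image. That `F` is prime follows from smoothness: a linear factor and its cofactor would
meet in a singular point (`isPrime_span_of_isSmoothHypersurface`).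

For the Fermat cubic, `x³ + y³` is a multiple of the trace of `z² z̄` with `z = (x + y) + (x - y)√-3`.
The same argument applies with `J` the multiplication by `√-3`, whether or not `-3` is a square in
`k`; in place of a chart of the Grassmannian one normalizes the first coordinate `z₀` to be constant.
-/

open MvPolynomial

/-! ### Birational parametrizations and function fields -/

lemma aeval_mul_left_of_isHomogeneous {R S ι : Type*} [CommRing R] [CommRing S]
    [Algebra R S] {b : MvPolynomial ι R} {d : ℕ} (hb : b.IsHomogeneous d) (r : S) (v : ι → S) :
    aeval (fun i => r * v i) b = r ^ d * aeval v b := by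
  rw [b.as_sum, map_sum, map_sum, Finset.mul_sum]
  refine Finset.sum_congr rfl fun s hs => ?_
  rw [aeval_monomial, aeval_monomial, Finsupp.prod, Finsupp.prod]
  simp only [mul_pow, Finset.prod_mul_distrib]
  rw [Finset.prod_pow_eq_pow_sum, hb.degree_eq_sum_deg_support hs]
  ring

section FunctionField

variable {k ι τ : Type*} [Field k] {F : MvPolynomial ι k}

lemma toFrac_eq_iff {a b : MvPolynomial ι k} :
    toFrac F a = toFrac F b ↔ a - b ∈ Ideal.span {F} := by
  rw [toFrac, toFrac, (IsFractionRing.injective (HomogCoordRing F) _).eq_iff, Ideal.Quotient.eq]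

lemma toFrac_mul (a b : MvPolynomial ι k) : toFrac F (a * b) = toFrac F a * toFrac F b := by
  simp [toFrac]

lemma toFrac_add (a b : MvPolynomial ι k) : toFrac F (a + b) = toFrac F a + toFrac F b := by
  simp [toFrac]

lemma mk_mem_nonZeroDivisors (hF : (Ideal.span {F}).IsPrime) {b : MvPolynomial ι k} :
    Ideal.Quotient.mk (Ideal.span {F}) b ∈ nonZeroDivisors (HomogCoordRing F) ↔
      b ∉ Ideal.span {F} := by
  have := Ideal.Quotient.isDomain (Ideal.span {F})
  rw [mem_nonZeroDivisors_iff_ne_zero, ne_eq, Ideal.Quotient.eq_zero_iff_mem]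

lemma isUnit_toFrac (hF : (Ideal.span {F}).IsPrime) {b : MvPolynomial ι k}
    (hb : b ∉ Ideal.span {F}) : IsUnit (toFrac F b) :=
  IsLocalization.map_units (FractionRing (HomogCoordRing F))
    (⟨_, (mk_mem_nonZeroDivisors hF).2 hb⟩ : nonZeroDivisors (HomogCoordRing F))

/-- A dominant rational map into an integral projective hypersurface whose pull-back hits every
coordinate of the affine space is birational: the pull-back of rational functions is automatically
well defined and injective, and its image is a field containing the coordinates. -/
theorem isBirationalParametrization_of_coordinates (hF : (Ideal.span {F}).IsPrime)
    (φ : ι → MvPolynomial τ k) (hφ : aeval φ F = 0)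
    (hdom : ∀ (d : ℕ) (b : MvPolynomial ι k), b.IsHomogeneous d → b ∉ Ideal.span {F} →
      aeval φ b ≠ 0)
    (m : ℕ) (D : MvPolynomial ι k) (Q : τ → MvPolynomial ι k) (hDm : D.IsHomogeneous m)
    (hQm : ∀ j, (Q j).IsHomogeneous m) (hD : D ∉ Ideal.span {F})
    (hQ : ∀ j, aeval φ (Q j) = X j * aeval φ D) :
    IsBirationalParametrization F φ := by
  classical
  have hker : ∀ a ∈ Ideal.span {F}, aeval φ a = 0 := by
    intro a ha
    obtain ⟨c, rfl⟩ := Ideal.mem_span_singleton'.1 ha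
    rw [map_mul, hφ, mul_zero]
  set K := FractionRing (MvPolynomial τ k)
  have hinj : Function.Injective (algebraMap (MvPolynomial τ k) K) := IsFractionRing.injective _ _
  have hne : ∀ (d : ℕ) (b : MvPolynomial ι k), b.IsHomogeneous d → b ∉ Ideal.span {F} →
      algebraMap (MvPolynomial τ k) K (aeval φ b) ≠ 0 := fun d b h1 h2 h3 =>
    hdom d b h1 h2 (hinj (by rw [h3, map_zero]))
  -- the pull-back does not depend on the fraction chosen to represent a rational function
  have huniq : ∀ (z : FractionRing (HomogCoordRing F)) (a b a' b' : MvPolynomial ι k),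
      z * toFrac F b = toFrac F a → z * toFrac F b' = toFrac F a' →
      aeval φ a * aeval φ b' = aeval φ a' * aeval φ b := by
    intro z a b a' b' h h'
    have : toFrac F (a * b') = toFrac F (a' * b) := by
      rw [toFrac_mul, toFrac_mul, ← h, ← h']; ring
    have := hker _ (toFrac_eq_iff.1 this)
    rwa [map_sub, map_mul, map_mul, sub_eq_zero] at this
  have hrep : ∀ z : functionFieldOf F, ∃ (d : ℕ) (a b : MvPolynomial ι k), a.IsHomogeneous d ∧
      b.IsHomogeneous d ∧ b ∉ Ideal.span {F} ∧
      (z : FractionRing (HomogCoordRing F)) * toFrac F b = toFrac F a := by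
    rintro ⟨z, d, a, b, ha, hb, hb0, h⟩
    exact ⟨d, a, b, ha, hb, (mk_mem_nonZeroDivisors hF).1 hb0, h⟩
  choose dg nu de hnu hde hde0 hz using hrep
  let f : functionFieldOf F → K := fun z =>
    algebraMap _ K (aeval φ (nu z)) / algebraMap _ K (aeval φ (de z))
  have hf : ∀ (z : functionFieldOf F) (d : ℕ) (a b : MvPolynomial ι k),
      b.IsHomogeneous d → b ∉ Ideal.span {F} →
      (z : FractionRing (HomogCoordRing F)) * toFrac F b = toFrac F a →
      f z = algebraMap _ K (aeval φ a) / algebraMap _ K (aeval φ b) := by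
    intro z d a b hb hb0 h
    rw [div_eq_div_iff (hne _ _ (hde z) (hde0 z)) (hne _ _ hb hb0), ← map_mul (algebraMap _ K),
      huniq _ _ _ _ _ (hz z) h, map_mul (algebraMap _ K)]
  have hnm : ∀ z w, de z * de w ∉ Ideal.span {F} := fun z w h =>
    (hF.mem_or_mem h).elim (hde0 z) (hde0 w)
  have halg : ∀ r : k, f (algebraMap k _ r) = algebraMap k K r := by
    intro r
    rw [hf (algebraMap k _ r) 0 (C r) 1 (isHomogeneous_one _ _)
      (fun h => hF.ne_top ((Ideal.eq_top_iff_one _).2 h))]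
    · rw [map_one, map_one, div_one, aeval_C, ← IsScalarTower.algebraMap_apply]
    · simp only [toFrac, map_one, mul_one]
      change algebraMap k (FractionRing (HomogCoordRing F)) r = _
      rw [IsScalarTower.algebraMap_apply k (HomogCoordRing F) (FractionRing (HomogCoordRing F))]
      rfl
  let Ψ : functionFieldOf F →ₐ[k] K :=
    { toFun := f
      map_one' := by simpa using halg 1
      map_zero' := by simpa using halg 0
      map_mul' := by
        intro z w
        rw [hf (z * w) _ (nu z * nu w) (de z * de w) ((hde z).mul (hde w)) (hnm z w)
          (by
            rw [toFrac_mul, toFrac_mul, ← hz, ← hz, Subalgebra.coe_mul]; ring)]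
        simp only [map_mul, f]
        rw [div_mul_div_comm]
      map_add' := by
        intro z w
        rw [hf (z + w) _ (nu z * de w + de z * nu w) (de z * de w) ((hde z).mul (hde w)) (hnm z w)
          (by
            rw [toFrac_mul, toFrac_add, toFrac_mul, toFrac_mul, ← hz, ← hz, Subalgebra.coe_add]
            ring)]
        simp only [map_mul, map_add, f]
        rw [div_add_div _ _ (hne _ _ (hde z) (hde0 z)) (hne _ _ (hde w) (hde0 w))]
      commutes' := halg }
  have hΨ : ∀ z, Ψ z = f z := fun _ => rfl
  have hΨ0 : ∀ z, Ψ z = 0 → nu z ∈ Ideal.span {F} := by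
    intro z h
    by_contra h0
    rw [hΨ] at h
    exact (div_ne_zero (hne _ _ (hnu z) h0) (hne _ _ (hde z) (hde0 z))) h
  have hΨinj : Function.Injective Ψ := by
    rw [injective_iff_map_eq_zero]
    intro z h
    have h1 : toFrac F (nu z) = 0 := by
      have : toFrac F (nu z) = toFrac F 0 := toFrac_eq_iff.2 (by simpa using hΨ0 z h)
      rw [this]; simp [toFrac]
    have h2 := hz z
    rw [h1] at h2
    exact Subtype.ext ((isUnit_toFrac hF (hde0 z)).mul_left_eq_zero.1 h2)
  -- every quotient of forms of equal degree defines an element of the function field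
  have hmk : ∀ (d : ℕ) (a b : MvPolynomial ι k), a.IsHomogeneous d → b.IsHomogeneous d →
      b ∉ Ideal.span {F} → ∃ z, Ψ z = algebraMap _ K (aeval φ a) / algebraMap _ K (aeval φ b) := by
    intro d a b ha hb hb0
    obtain ⟨c, hc⟩ := (isUnit_toFrac hF hb0).exists_left_inv
    have h : (toFrac F a * c) * toFrac F b = toFrac F a := by rw [mul_assoc, hc, mul_one]
    exact ⟨⟨toFrac F a * c, d, a, b, ha, hb, (mk_mem_nonZeroDivisors hF).2 hb0, h⟩,
      hf _ d a b hb hb0 h⟩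
  have hpoly : ∀ p : MvPolynomial τ k, algebraMap _ K p ∈ Ψ.range := by
    intro p
    induction p using MvPolynomial.induction_on with
    | C r =>
      have := Ψ.range.algebraMap_mem r
      rwa [IsScalarTower.algebraMap_apply k (MvPolynomial τ k) K] at this
    | add p q hp hq => rw [map_add]; exact add_mem hp hq
    | mul_X p j hp =>
      rw [map_mul]
      refine mul_mem hp ?_
      obtain ⟨z, hz⟩ := hmk m (Q j) D (hQm j) hDm hD
      refine ⟨z, ?_⟩
      change Ψ z = _
      rw [hz, hQ, map_mul, mul_div_cancel_right₀ _ (hne _ _ hDm hD)]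
  have hsurj : Function.Surjective Ψ := by
    intro y
    obtain ⟨p, q, hq, rfl⟩ := IsFractionRing.div_surjective (MvPolynomial τ k) y
    obtain ⟨z, hz⟩ := hpoly p
    obtain ⟨w, hw⟩ := hpoly q
    have hw0 : nu w ∉ Ideal.span {F} := by
      intro h
      have hq0 : algebraMap (MvPolynomial τ k) K q ≠ 0 :=
        fun h => nonZeroDivisors.ne_zero hq (hinj (by rw [h, map_zero]))
      refine hq0 (hw.symm.trans ?_)
      change f w = 0
      simp only [f, hker _ h, map_zero, zero_div]
    obtain ⟨v, hv⟩ := hmk _ _ _ (hde w) (hnu w) hw0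
    refine ⟨z * v, ?_⟩
    rw [map_mul, hv]
    change Ψ z = _ at hz
    change f w = _ at hw
    rw [hz, ← hw]
    simp only [f]
    rw [div_div_eq_mul_div, mul_div_assoc]
  refine ⟨hF, hφ, hdom, AlgEquiv.ofBijective Ψ ⟨hΨinj, hsurj⟩, ?_⟩
  intro z d a b _ hb hb0 h
  change f z * _ = _
  rw [hf z d a b hb hb0 h, div_mul_cancel₀ _ (hne _ _ hb hb0)]

/-- A birational parametrization by `m` coordinates shows that the hypersurface is rational. -/
theorem IsBirationalParametrization.isRationalHypersurface {φ : ι → MvPolynomial τ k}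
    (h : IsBirationalParametrization F φ) {m : ℕ} (e : τ ≃ Fin m) :
    IsRationalHypersurface m F := by
  obtain ⟨hF, -, -, Φ, -⟩ := h
  let g : FractionRing (MvPolynomial τ k) ≃ₐ[k] FractionRing (MvPolynomial (Fin m) k) :=
    IsFractionRing.fieldEquivOfAlgEquiv k _ _ (renameEquiv k e)
  exact ⟨hF, ⟨Φ.trans g⟩⟩

/-- If substituting `φ = E • x + F • y` (with `E` not vanishing on `F = 0`) into a form gives zero,
then the form lies in `(F)`: modulo `F` the substitution only rescales the coordinates. -/
lemma mem_span_of_aeval_eq_zero (hF : (Ideal.span {F}).IsPrime) {E : MvPolynomial ι k}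
    (hE : E ∉ Ideal.span {F}) (y : ι → MvPolynomial ι k) {d : ℕ} {b : MvPolynomial ι k}
    (hb : b.IsHomogeneous d) (h : aeval (fun i => E * X i + F * y i) b = 0) :
    b ∈ Ideal.span {F} := by
  have h1 : Ideal.Quotient.mk (Ideal.span {F}) (aeval (fun i => E * X i + F * y i) b) =
      Ideal.Quotient.mk (Ideal.span {F}) (E ^ d * b) := by
    have hmk : ∀ i, Ideal.Quotient.mkₐ k (Ideal.span {F}) (E * X i + F * y i) =
        Ideal.Quotient.mkₐ k (Ideal.span {F}) (E * X i) := by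
      intro i
      refine Ideal.Quotient.eq.2 ?_
      rw [add_sub_cancel_left]
      exact Ideal.mul_mem_right _ _ (Ideal.mem_span_singleton_self F)
    have h2 : aeval (fun i => E * X i) b = E ^ d * b := by
      rw [aeval_mul_left_of_isHomogeneous hb, aeval_X_left_apply]
    rw [← h2]
    change Ideal.Quotient.mkₐ k _ _ = Ideal.Quotient.mkₐ k _ _
    rw [← AlgHom.comp_apply, ← AlgHom.comp_apply, comp_aeval, comp_aeval]
    congr 2
    exact funext hmk
  rw [h, map_zero, eq_comm, Ideal.Quotient.eq_zero_iff_mem] at h1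
  rcases hF.mem_or_mem h1 with h | h
  · exact absurd (hF.mem_of_pow_mem _ h) hE
  · exact h

end FunctionField

/-! ### Third points for an operator `J` with `J² = d` -/

section Forms

variable {k ι τ : Type*} [Field k]

lemma notMem_span_of_isHomogeneous_of_lt {F D : MvPolynomial ι k} {m n : ℕ}
    (hF : F.IsHomogeneous n) (hD : D.IsHomogeneous m) (hmn : m < n) (hD0 : D ≠ 0) :
    D ∉ Ideal.span {F} := by
  intro h
  obtain ⟨c, rfl⟩ := Ideal.mem_span_singleton'.1 h
  have hc : c ≠ 0 := left_ne_zero_of_mul hD0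
  have hF0 : F ≠ 0 := right_ne_zero_of_mul hD0
  have h1 := totalDegree_mul_of_isDomain hc hF0
  rw [hD.totalDegree hD0, hF.totalDegree hF0] at h1
  omega

/-- A multiple of a form which is a form of the same degree is a constant multiple. -/
lemma exists_eq_C_mul_of_mem_span {F E : MvPolynomial ι k} {n : ℕ}
    (hF : F.IsHomogeneous n) (hE : E.IsHomogeneous n) (h : E ∈ Ideal.span {F}) :
    ∃ c : k, E = C c * F := by
  obtain ⟨c, rfl⟩ := Ideal.mem_span_singleton'.1 h
  by_cases h0 : c * F = 0
  · exact ⟨0, by rw [h0]; simp⟩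
  have h1 := totalDegree_mul_of_isDomain (left_ne_zero_of_mul h0) (right_ne_zero_of_mul h0)
  rw [hE.totalDegree h0, hF.totalDegree (right_ne_zero_of_mul h0)] at h1
  exact ⟨coeff 0 c, by rw [← totalDegree_eq_zero_iff_eq_C.1 (by omega)]⟩

lemma eval_aeval (P : ι → MvPolynomial τ k) (t : τ → k) (G : MvPolynomial ι k) :
    eval t (aeval P G) = eval (fun i => eval t (P i)) G := by
  rw [← aeval_eq_eval, ← AlgHom.comp_apply, comp_aeval]
  rfl

/-- For `J² = d`, the vector `F(J x) x + d F(x) J x`. When `J` is multiplication by `δ = √d` and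
`F` vanishes on the `±δ`-eigenspaces of `J`, this is the third point of `F = 0` on the line through
the two eigenvectors `J x ± δ x`. -/
noncomputable def thirdPoint (F : MvPolynomial ι k) (d : k) (J : (ι → k) →ₗ[k] (ι → k))
    (x : ι → k) : ι → k :=
  eval (J x) F • x + (d * eval x F) • J x

section

variable {F : MvPolynomial ι k} {d : k} {J : (ι → k) →ₗ[k] (ι → k)}

/-- The action of `a + b√d` on vectors through an operator `J` with `J² = d`. -/
def quadSMul (J : (ι → k) →ₗ[k] (ι → k)) (a b : k) (x : ι → k) : ι → k := a • x + b • J x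

lemma map_quadSMul (hJ : ∀ x, J (J x) = d • x) (a b : k) (x : ι → k) :
    J (quadSMul J a b x) = quadSMul J (d * b) a x := by
  simp only [quadSMul, map_add, map_smul, hJ, smul_smul]
  rw [add_comm, mul_comm]

lemma thirdPoint_eq_quadSMul (x : ι → k) :
    thirdPoint F d J x = quadSMul J (eval (J x) F) (d * eval x F) x := rfl

/-- The third point only depends on the line: it is rescaled by the square of the norm of `a + b√d`
when `x` is multiplied by `a + b√d`. -/
lemma thirdPoint_quadSMul (hd : d ≠ 0) (hJ : ∀ x, J (J x) = d • x)
    (hFJ : ∀ a b x, eval (quadSMul J a b x) F =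
      (a ^ 2 - d * b ^ 2) * (a * eval x F - b * eval (J x) F / d)) (a b : k) (x : ι → k) :
    thirdPoint F d J (quadSMul J a b x) = (a ^ 2 - d * b ^ 2) ^ 2 • thirdPoint F d J x := by
  rw [thirdPoint, map_quadSMul hJ, hFJ, hFJ]
  ext i
  simp only [thirdPoint, quadSMul, Pi.add_apply, Pi.smul_apply, smul_eq_mul]
  field_simp
  ring

end

variable [Fintype ι] [DecidableEq ι]

/-- The linear form in the variables `X i` that represents a linear functional. -/
noncomputable def linForm (f : (ι → k) →ₗ[k] k) : MvPolynomial ι k :=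
  ∑ i, C (f (Pi.single i 1)) * X i

@[simp]
lemma eval_linForm (f : (ι → k) →ₗ[k] k) (x : ι → k) : eval x (linForm f) = f x := by
  rw [LinearMap.pi_apply_eq_sum_univ f x]
  simp only [linForm, map_sum, map_mul, eval_C, eval_X, smul_eq_mul]
  refine Finset.sum_congr rfl fun i _ => ?_
  rw [mul_comm]
  congr 2
  ext j
  simp [Pi.single_apply, eq_comm]

lemma isHomogeneous_linForm (f : (ι → k) →ₗ[k] k) : (linForm f).IsHomogeneous 1 :=
  IsHomogeneous.sum _ _ _ fun _ _ => isHomogeneous_C_mul_X _ _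

/-- The form `x ↦ F (J x)`. -/
noncomputable def compForm (F : MvPolynomial ι k) (J : (ι → k) →ₗ[k] (ι → k)) :
    MvPolynomial ι k :=
  aeval (fun i => linForm (LinearMap.proj i ∘ₗ J)) F

@[simp]
lemma eval_compForm (F : MvPolynomial ι k) (J : (ι → k) →ₗ[k] (ι → k)) (x : ι → k) :
    eval x (compForm F J) = eval (J x) F := by
  rw [compForm, eval_aeval]
  simp only [eval_linForm]
  rfl

lemma isHomogeneous_compForm {F : MvPolynomial ι k} {n : ℕ} (hF : F.IsHomogeneous n)
    (J : (ι → k) →ₗ[k] (ι → k)) : (compForm F J).IsHomogeneous n := by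
  have hg : ∀ i, (linForm (LinearMap.proj i ∘ₗ J : (ι → k) →ₗ[k] k)).IsHomogeneous 1 :=
    fun i => isHomogeneous_linForm _
  have h := IsHomogeneous.aeval (n := 1) hF _ hg
  rwa [one_mul] at h

/-- The polynomials `thirdPoint F d J P` for a vector `P` of polynomials. -/
noncomputable def thirdPointPoly (F : MvPolynomial ι k) (d : k) (J : (ι → k) →ₗ[k] (ι → k))
    (P : ι → MvPolynomial τ k) (i : ι) : MvPolynomial τ k :=
  aeval P (compForm F J) * P i + C d * aeval P F * aeval P (linForm (LinearMap.proj i ∘ₗ J))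

lemma eval_thirdPointPoly (F : MvPolynomial ι k) (d : k) (J : (ι → k) →ₗ[k] (ι → k))
    (P : ι → MvPolynomial τ k) (t : τ → k) :
    (fun i => eval t (thirdPointPoly F d J P i)) =
      thirdPoint F d J (fun i => eval t (P i)) := by
  ext i
  simp only [thirdPointPoly, map_add, map_mul, eval_C, eval_aeval, eval_linForm, eval_compForm,
    thirdPoint, Pi.add_apply, Pi.smul_apply, smul_eq_mul, LinearMap.comp_apply,
    LinearMap.proj_apply]

variable {F : MvPolynomial ι k} {d : k} {J : (ι → k) →ₗ[k] (ι → k)}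

/-- Let `F` be a prime cubic form such that `F(ax + bJx)` is the norm of `a + b√d` times a form
linear in `(a, b)`, for an operator `J` with `J² = d`. Suppose that `P` parametrizes vectors up to
the action of `k[J]`, with inverse given by ratios `Q j / D` of quadratic forms. Then the third
point of `P` is a birational parametrization of `F = 0`. -/
theorem isBirationalParametrization_thirdPointPoly [Infinite k] (hF3 : F.IsHomogeneous 3)
    (hF : (Ideal.span {F}).IsPrime) (hd : d ≠ 0) (hJ : ∀ x, J (J x) = d • x)
    (hFJ : ∀ a b x, eval (quadSMul J a b x) F =
      (a ^ 2 - d * b ^ 2) * (a * eval x F - b * eval (J x) F / d))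
    (hE : compForm F J ∉ Ideal.span {F}) (P : ι → MvPolynomial τ k)
    (D : MvPolynomial ι k) (Q : τ → MvPolynomial ι k) (hD2 : D.IsHomogeneous 2) (hD0 : D ≠ 0)
    (hQ2 : ∀ j, (Q j).IsHomogeneous 2)
    (hDJ : ∀ a b x, eval (quadSMul J a b x) D = (a ^ 2 - d * b ^ 2) * eval x D)
    (hQJ : ∀ j a b x, eval (quadSMul J a b x) (Q j) = (a ^ 2 - d * b ^ 2) * eval x (Q j))
    (hQP : ∀ t j, eval (fun i => eval t (P i)) (Q j) = t j * eval (fun i => eval t (P i)) D)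
    (M : MvPolynomial ι k) (hM0 : M ≠ 0)
    (hM : ∀ x, eval x D ≠ 0 → eval x M ≠ 0 → ∃ (t : τ → k) (a b : k), a ^ 2 - d * b ^ 2 ≠ 0 ∧
      (fun i => eval t (P i)) = quadSMul J a b x) :
    IsBirationalParametrization F (thirdPointPoly F d J P) := by
  refine isBirationalParametrization_of_coordinates hF _ ?_ ?_ 2 D Q hD2 hQ2
    (notMem_span_of_isHomogeneous_of_lt hF3 hD2 (by norm_num) hD0) ?_
  · refine MvPolynomial.funext fun t => ?_
    rw [eval_aeval, eval_thirdPointPoly, thirdPoint_eq_quadSMul, hFJ, map_zero]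
    field_simp
    ring
  · intro e b hb hbF hb0
    refine hbF (mem_span_of_aeval_eq_zero hF hE
      (fun i => C d * linForm (LinearMap.proj i ∘ₗ J)) hb ?_)
    have h : D * M * aeval (fun i => compForm F J * X i +
        F * (C d * linForm (LinearMap.proj i ∘ₗ J))) b = 0 := by
      refine MvPolynomial.funext fun x => ?_
      rw [map_zero, map_mul, map_mul, mul_eq_zero, mul_eq_zero]
      by_contra! h
      obtain ⟨⟨h1, h2⟩, h3⟩ := h
      obtain ⟨t, a, c, hac, ht⟩ := hM x h1 h2
      have h4 : eval t (aeval (thirdPointPoly F d J P) b) = 0 := by rw [hb0, map_zero]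
      rw [eval_aeval, eval_thirdPointPoly, ht, thirdPoint_quadSMul hd hJ hFJ] at h4
      have h5 : ∀ (r : k) (v : ι → k), eval (r • v) b = r ^ e * eval v b :=
        fun r v => aeval_mul_left_of_isHomogeneous hb r v
      rw [h5, mul_eq_zero] at h4
      refine h3 (Eq.trans ?_ (h4.resolve_left (pow_ne_zero _ (pow_ne_zero _ hac))))
      rw [eval_aeval]
      have h6 : (fun i => eval x (compForm F J * X i +
          F * (C d * linForm (LinearMap.proj i ∘ₗ J)))) = thirdPoint F d J x := by
        ext i
        simp only [map_add, map_mul, eval_X, eval_C, eval_linForm, eval_compForm, thirdPoint,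
          Pi.add_apply, Pi.smul_apply, smul_eq_mul, LinearMap.comp_apply, LinearMap.proj_apply]
        ring
      rw [h6]
    rcases mul_eq_zero.1 h with h | h
    · exact absurd h (mul_ne_zero hD0 hM0)
    · exact h
  · intro j
    refine MvPolynomial.funext fun t => ?_
    rw [map_mul, eval_aeval, eval_aeval, eval_thirdPointPoly, thirdPoint_eq_quadSMul, hQJ, hDJ,
      hQP, eval_X]
    ring

end Forms

/-! ### Smooth cubic hypersurfaces are integral -/

section Irreducible

variable {k ι : Type*} [Field k]

section Expansion

variable {A B : Type*} [CommRing A] [CommRing B] [Algebra k A] [Algebra k B] [Algebra A B]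
  [IsScalarTower k A B]

lemma aeval_combination_of_isHomogeneous_one {l : MvPolynomial ι k} (hl : l.IsHomogeneous 1)
    (v w : ι → A) (α β : B) :
    aeval (fun i => α * algebraMap A B (v i) + β * algebraMap A B (w i)) l =
      α * algebraMap A B (aeval v l) + β * algebraMap A B (aeval w l) := by
  have hl' : l ∈ Submodule.span k (Set.range X) := by
    rw [← homogeneousSubmodule_one_eq_span_X]; exact hl
  induction hl' using Submodule.span_induction with
  | mem x hx => obtain ⟨i, rfl⟩ := hx; simp
  | zero => simp
  | add p q hp hq ihp ihq =>
    rw [← homogeneousSubmodule_one_eq_span_X] at hp hq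
    simp only [map_add, ihp hp, ihq hq]; ring
  | smul c p hp ih =>
    rw [← homogeneousSubmodule_one_eq_span_X] at hp
    simp only [smul_eq_C_mul, map_mul, ih hp, aeval_C, ← IsScalarTower.algebraMap_apply k A B]
    ring

variable (B) in
lemma exists_aeval_combination_of_isHomogeneous_two {Q : MvPolynomial ι k}
    (hQ : Q.IsHomogeneous 2) (v w : ι → A) :
    ∃ c : A, ∀ α β : B,
      aeval (fun i => α * algebraMap A B (v i) + β * algebraMap A B (w i)) Q =
        α ^ 2 * algebraMap A B (aeval v Q) + α * β * algebraMap A B c +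
          β ^ 2 * algebraMap A B (aeval w Q) := by
  have hQ' : Q ∈ homogeneousSubmodule ι k 1 * homogeneousSubmodule ι k 1 := by
    rw [← pow_two, homogeneousSubmodule_one_pow]; exact hQ
  clear hQ
  induction hQ' using Submodule.mul_induction_on' with
  | mem_mul_mem l hl m hm =>
    refine ⟨aeval v l * aeval w m + aeval w l * aeval v m, fun α β => ?_⟩
    rw [map_mul, aeval_combination_of_isHomogeneous_one hl,
      aeval_combination_of_isHomogeneous_one hm]
    simp only [map_mul, map_add]
    ring
  | add p _ q _ hp hq =>
    obtain ⟨c, hc⟩ := hp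
    obtain ⟨c', hc'⟩ := hq
    refine ⟨c + c', fun α β => ?_⟩
    simp only [map_add, hc, hc']
    ring

variable (B) in
/-- A cubic form on a pencil spanned by two vectors over `A`: the coefficients lie in `A`, while
the parameters of the pencil may come from any `A`-algebra. -/
lemma exists_aeval_combination_of_isHomogeneous_three {F : MvPolynomial ι k}
    (hF : F.IsHomogeneous 3) (v w : ι → A) :
    ∃ c c' : A, ∀ α β : B,
      aeval (fun i => α * algebraMap A B (v i) + β * algebraMap A B (w i)) F =
        α ^ 3 * algebraMap A B (aeval v F) + α ^ 2 * β * algebraMap A B c +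
          α * β ^ 2 * algebraMap A B c' + β ^ 3 * algebraMap A B (aeval w F) := by
  have hF' : F ∈ homogeneousSubmodule ι k 2 * homogeneousSubmodule ι k 1 := by
    rw [← homogeneousSubmodule_one_pow (σ := ι) (R := k) 2, ← pow_succ, homogeneousSubmodule_one_pow]
    exact hF
  clear hF
  induction hF' using Submodule.mul_induction_on' with
  | mem_mul_mem Q hQ l hl =>
    obtain ⟨c, hc⟩ := exists_aeval_combination_of_isHomogeneous_two B hQ v w
    refine ⟨aeval v Q * aeval w l + c * aeval v l, aeval w Q * aeval v l + c * aeval w l,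
      fun α β => ?_⟩
    rw [map_mul, aeval_combination_of_isHomogeneous_one hl, hc]
    simp only [map_mul, map_add]
    ring
  | add p _ q _ hp hq =>
    obtain ⟨c, c', hc⟩ := hp
    obtain ⟨e, e', he⟩ := hq
    refine ⟨c + e, c' + e', fun α β => ?_⟩
    simp only [map_add, hc, he]
    ring

end Expansion

/-- A line and a conic in a projective space of dimension at least two have a common point over an
algebraically closed field. -/
lemma exists_common_zero {K : Type*} [Field K] [Algebra k K] [IsAlgClosed K] [Fintype ι]
    (hι : 3 ≤ Fintype.card ι) {l Q : MvPolynomial ι k} (hl : l.IsHomogeneous 1)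
    (hQ : Q.IsHomogeneous 2) : ∃ v : ι → K, v ≠ 0 ∧ aeval v l = 0 ∧ aeval v Q = 0 := by
  have hlin := fun (v w : ι → K) (α β : K) =>
    aeval_combination_of_isHomogeneous_one (B := K) hl v w α β
  let f : (ι → K) →ₗ[K] K :=
    { toFun := fun v => aeval v l
      map_add' := fun v w => by
        have h := hlin v w 1 1
        simp only [Algebra.algebraMap_self, RingHom.id_apply, one_mul] at h
        exact h
      map_smul' := fun c v => by
        have h := hlin v 0 c 0
        simp only [Algebra.algebraMap_self, RingHom.id_apply, zero_mul, add_zero] at h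
        exact h }
  have hdim : 1 < Module.finrank K (LinearMap.ker f) := by
    have h1 := LinearMap.finrank_range_add_finrank_ker f
    have h2 := Submodule.finrank_le (LinearMap.range f)
    rw [Module.finrank_self] at h2
    rw [Module.finrank_fintype_fun_eq_card] at h1
    omega
  have : Nontrivial (LinearMap.ker f) := Module.nontrivial_of_finrank_pos (R := K) (by omega)
  obtain ⟨w, hw⟩ := exists_ne (0 : LinearMap.ker f)
  obtain ⟨v, hv⟩ := exists_linearIndependent_pair_of_one_lt_finrank hdim hw
  by_cases hQw : aeval (w : ι → K) Q = 0
  · exact ⟨w, by simpa using hw, w.2, hQw⟩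
  obtain ⟨c, hc⟩ := exists_aeval_combination_of_isHomogeneous_two K hQ (v : ι → K) (w : ι → K)
  obtain ⟨t, ht⟩ := IsAlgClosed.exists_root
    (Polynomial.C (aeval (w : ι → K) Q) * Polynomial.X ^ 2 + Polynomial.C c * Polynomial.X +
      Polynomial.C (aeval (v : ι → K) Q))
    (by rw [Polynomial.degree_quadratic hQw]; norm_num)
  refine ⟨((v + t • w : LinearMap.ker f) : ι → K), ?_, (v + t • w).2, ?_⟩
  · intro h
    have h0 : (1 : K) • v + t • w = 0 := by rw [one_smul]; exact Subtype.ext h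
    have := LinearIndependent.pair_iff.1 hv t 1 (by rw [add_comm]; exact h0)
    exact one_ne_zero this.2
  · have := hc 1 t
    simp only [Algebra.algebraMap_self, RingHom.id_apply, one_mul, one_pow] at this
    change aeval (fun i => (v : ι → K) i + t * (w : ι → K) i) Q = 0
    rw [this]
    simp only [Polynomial.IsRoot, Polynomial.eval_add, Polynomial.eval_mul, Polynomial.eval_C,
      Polynomial.eval_pow, Polynomial.eval_X] at ht
    linear_combination ht

/-- A cubic form which is a product of polynomials of degrees one and two is the product of their
top degree parts. -/
lemma exists_homogeneous_factors {F G H : MvPolynomial ι k} (hF : F.IsHomogeneous 3)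
    (hFGH : F = G * H) (hG : G.totalDegree = 1) (hH : H.totalDegree = 2) :
    ∃ l Q : MvPolynomial ι k, l.IsHomogeneous 1 ∧ Q.IsHomogeneous 2 ∧ F = l * Q := by
  refine ⟨homogeneousComponent 1 G, homogeneousComponent 2 H,
    homogeneousComponent_isHomogeneous _ _, homogeneousComponent_isHomogeneous _ _, ?_⟩
  have hc : ∀ i j, homogeneousComponent 3 (homogeneousComponent i G * homogeneousComponent j H) =
      if 3 = i + j then homogeneousComponent i G * homogeneousComponent j H else 0 := fun i j =>
    homogeneousComponent_of_mem ((homogeneousComponent_isHomogeneous i G).mul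
      (homogeneousComponent_isHomogeneous j H))
  have h := homogeneousComponent_eq_self ((mem_homogeneousSubmodule _ _).2 hF)
  rw [← h, hFGH]
  conv_lhs => rw [← sum_homogeneousComponent G, ← sum_homogeneousComponent H, hG, hH]
  simp only [Finset.sum_range_succ, Finset.sum_range_zero, zero_add, add_mul, mul_add, map_add, hc]
  norm_num

lemma IsSmoothHypersurface.ne_zero [Nonempty ι] {F : MvPolynomial ι k}
    (hs : IsSmoothHypersurface F) : F ≠ 0 := by
  rintro rfl
  obtain ⟨i, hi⟩ := hs 1 one_ne_zero (map_zero _)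
  simp at hi

/-- A smooth cubic hypersurface of positive dimension is integral: a linear factor of a cubic form
produces singular points where the two components meet. -/
theorem isPrime_span_of_isSmoothHypersurface [Fintype ι] (hι : 3 ≤ Fintype.card ι)
    {F : MvPolynomial ι k} (hF : F.IsHomogeneous 3) (hs : IsSmoothHypersurface F) :
    (Ideal.span {F}).IsPrime := by
  have : Nonempty ι := Fintype.card_pos_iff.1 (by omega)
  have hF0 : F ≠ 0 := hs.ne_zero
  rw [Ideal.span_singleton_prime hF0, ← irreducible_iff_prime]
  have key : ∀ G H : MvPolynomial ι k, F = G * H → G.totalDegree = 1 → H.totalDegree = 2 →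
      False := by
    intro G H hGH hG hH
    obtain ⟨l, Q, hl, hQ, rfl⟩ := exists_homogeneous_factors hF hGH hG hH
    obtain ⟨v, hv, hlv, hQv⟩ := exists_common_zero (K := AlgebraicClosure k) hι hl hQ
    obtain ⟨i, hi⟩ := hs v hv (by rw [map_mul, hlv, zero_mul])
    refine hi ?_
    rw [Derivation.leibniz, map_add, smul_eq_mul, smul_eq_mul, map_mul, map_mul, hlv, hQv]
    simp
  have hunit : ∀ G : MvPolynomial ι k, G ≠ 0 → G.totalDegree = 0 → IsUnit G := by
    intro G hG hdeg
    have h := totalDegree_eq_zero_iff_eq_C.1 hdeg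
    rw [h] at hG ⊢
    exact (isUnit_iff_ne_zero.2 fun h0 => hG (by rw [h0, map_zero])).map C
  constructor
  · intro h
    have h1 := (isUnit_iff_totalDegree_of_isReduced.1 h).2
    rw [hF.totalDegree hF0] at h1
    omega
  · intro G H hGH
    have hG0 : G ≠ 0 := by rintro rfl; exact hF0 (by rw [hGH, zero_mul])
    have hH0 : H ≠ 0 := by rintro rfl; exact hF0 (by rw [hGH, mul_zero])
    have hdeg := totalDegree_mul_of_isDomain hG0 hH0
    rw [← hGH, hF.totalDegree hF0] at hdeg
    have h1 : ¬ (G.totalDegree = 1 ∧ H.totalDegree = 2) := fun h => key G H hGH h.1 h.2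
    have h2 : ¬ (H.totalDegree = 1 ∧ G.totalDegree = 2) :=
      fun h => key H G (by rw [hGH, mul_comm]) h.1 h.2
    have h3 : G.totalDegree = 0 ∨ H.totalDegree = 0 := by omega
    exact h3.imp (hunit G hG0) (hunit H hH0)

end Irreducible

/-! ### Parametrization in a chart of the Grassmannian -/

lemma forall_fin_two_prod {α : Type*} {p : Fin 2 × α → Prop} (h₀ : ∀ i, p (0, i))
    (h₁ : ∀ i, p (1, i)) : ∀ j, p j := by
  rintro ⟨j, i⟩
  fin_cases j
  exacts [h₀ i, h₁ i]

section Wedge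

variable {k ι : Type*} [Field k] [Fintype ι] [DecidableEq ι]

/-- The quadratic form `x ↦ u(x) v(Jx) - u(Jx) v(x)`: a Plücker coordinate of the plane spanned by
`x` and `J x`. -/
noncomputable def wedgeForm (J : (ι → k) →ₗ[k] (ι → k)) (u v : (ι → k) →ₗ[k] k) :
    MvPolynomial ι k :=
  linForm u * linForm (v ∘ₗ J) - linForm (u ∘ₗ J) * linForm v

variable {J : (ι → k) →ₗ[k] (ι → k)} {d : k}

@[simp]
lemma eval_wedgeForm (u v : (ι → k) →ₗ[k] k) (x : ι → k) :
    eval x (wedgeForm J u v) = u x * v (J x) - u (J x) * v x := by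
  simp [wedgeForm]

lemma isHomogeneous_wedgeForm (u v : (ι → k) →ₗ[k] k) : (wedgeForm J u v).IsHomogeneous 2 :=
  ((isHomogeneous_linForm _).mul (isHomogeneous_linForm _)).sub
    ((isHomogeneous_linForm _).mul (isHomogeneous_linForm _))

lemma eval_wedgeForm_quadSMul (hJ : ∀ x, J (J x) = d • x) (u v : (ι → k) →ₗ[k] k) (a b : k)
    (x : ι → k) :
    eval (quadSMul J a b x) (wedgeForm J u v) =
      (a ^ 2 - d * b ^ 2) * eval x (wedgeForm J u v) := by
  rw [eval_wedgeForm, eval_wedgeForm, map_quadSMul hJ]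
  simp only [quadSMul, map_add, map_smul, smul_eq_mul]
  ring

/-- If `d` is not a square, then `F` does not divide `F ∘ J`: otherwise `F ∘ J = c F`, and applying
this twice gives `c² = d³`. -/
lemma compForm_notMem_span [Infinite k] {F : MvPolynomial ι k} (hF3 : F.IsHomogeneous 3)
    (hF0 : F ≠ 0) (hJ : ∀ x, J (J x) = d • x) (hd : ∀ c : k, c ^ 2 ≠ d) :
    compForm F J ∉ Ideal.span {F} := by
  intro h
  obtain ⟨c, hc⟩ := exists_eq_C_mul_of_mem_span hF3 (isHomogeneous_compForm hF3 J) h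
  have hd0 : d ≠ 0 := fun h => hd 0 (by rw [h]; ring)
  have h1 : ∀ x, eval (J x) F = c * eval x F := fun x => by
    rw [← eval_compForm, hc, map_mul, eval_C]
  obtain ⟨x, hx⟩ : ∃ x, eval x F ≠ 0 := by
    by_contra! h
    exact hF0 (MvPolynomial.funext fun x => by rw [h, map_zero])
  have h2 := h1 (J x)
  rw [hJ, h1] at h2
  have h3 : eval (d • x) F = d ^ 3 * eval x F := aeval_mul_left_of_isHomogeneous hF3 d x
  rw [h3] at h2
  have h4 : d ^ 3 = c ^ 2 := mul_right_cancel₀ hx (by rw [h2]; ring)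
  refine hd (c / d) ?_
  field_simp
  rw [← h4]

end Wedge

section Functionals

variable {k V Y : Type*} [Field k] [AddCommGroup V] [Module k V] [AddCommGroup Y] [Module k Y]
  [FiniteDimensional k Y]

/-- Let `J² = d` on `V` with `d` not a square. A surjection `pr : V → Y` with `pr` and `pr ∘ J`
jointly injective embeds the `k(√d)`-space `V` into `Y ⊗ k(√d)`; when the codimension is one, the
image is the kernel of a single `k(√d)`-linear functional, here written in terms of its two
components over `k`. -/
lemma exists_functionals {d : k} (hd : ∀ c : k, c ^ 2 ≠ d) {J : V →ₗ[k] V}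
    (hJ : ∀ x, J (J x) = d • x) {pr : V →ₗ[k] Y} (hpr : Function.Surjective pr)
    (hinj : ∀ x, pr x = 0 → pr (J x) = 0 → x = 0)
    (hdim : Module.finrank k V + 2 = 2 * Module.finrank k Y) :
    ∃ l₀ l₁ : Y →ₗ[k] k, (∃ y, l₁ y ≠ 0) ∧
      ∀ y y', (∃ x, pr x = y ∧ pr (J x) = y') ↔
        l₀ y + l₁ y' = 0 ∧ d * l₁ y + l₀ y' = 0 := by
  let R : V →ₗ[k] Y × Y := pr.prod (pr ∘ₗ J)
  have hR : Function.Injective R := by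
    rw [← LinearMap.ker_eq_bot, LinearMap.ker_eq_bot']
    intro x hx
    exact hinj x (congrArg Prod.fst hx) (congrArg Prod.snd hx)
  have hRdim : Module.finrank k (LinearMap.range R) = Module.finrank k V :=
    LinearMap.finrank_range_of_inj hR
  have hlt : LinearMap.range R < ⊤ := by
    refine lt_top_iff_ne_top.2 fun h => ?_
    rw [h, finrank_top, Module.finrank_prod] at hRdim
    omega
  obtain ⟨m, hm0, hm⟩ := Submodule.exists_le_ker_of_lt_top _ hlt
  let l₀ : Y →ₗ[k] k := m ∘ₗ LinearMap.inl k Y Y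
  let l₁ : Y →ₗ[k] k := m ∘ₗ LinearMap.inr k Y Y
  have hml : ∀ y y', m (y, y') = l₀ y + l₁ y' := fun y y' => by
    simp only [l₀, l₁, LinearMap.comp_apply, LinearMap.inl_apply, LinearMap.inr_apply, ← map_add,
      Prod.mk_add_mk, add_zero, zero_add]
  have h1 : ∀ x, l₀ (pr x) + l₁ (pr (J x)) = 0 := fun x => by
    rw [← hml]; exact hm (LinearMap.mem_range_self R x)
  have h2 : ∀ x, d * l₁ (pr x) + l₀ (pr (J x)) = 0 := fun x => by
    have := h1 (J x)
    rw [hJ, map_smul, map_smul, smul_eq_mul, add_comm] at this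
    exact this
  refine ⟨l₀, l₁, ?_, ?_⟩
  · by_contra! h
    refine hm0 (LinearMap.ext fun z => ?_)
    obtain ⟨x, hx⟩ := hpr z.1
    have := h1 x
    rw [h, add_zero, hx] at this
    rw [← Prod.mk.eta (p := z), hml, this, h, add_zero, LinearMap.zero_apply]
  -- the second component of the functional
  let m' : Y × Y →ₗ[k] k := LinearMap.coprod (d • l₁) l₀
  have hm' : ∀ y y', m' (y, y') = d * l₁ y + l₀ y' := fun y y' => by simp [m']
  have hsurj : Function.Surjective (m.prod m') := by
    obtain ⟨⟨y, y'⟩, hy⟩ : ∃ z, m z ≠ 0 := by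
      by_contra! h
      exact hm0 (LinearMap.ext h)
    have hΔ : d * m (y, y') ^ 2 - m' (y, y') ^ 2 ≠ 0 := by
      intro h
      refine hd (m' (y, y') / m (y, y')) ?_
      field_simp
      linear_combination -h
    have e1 : m (y', d • y) = m' (y, y') := by
      rw [hml, hm', map_smul, smul_eq_mul, add_comm]
    have e2 : m' (y', d • y) = d * m (y, y') := by
      rw [hml, hm', map_smul, smul_eq_mul]; ring
    intro ⟨p, q⟩
    refine ⟨((p * d * m (y, y') - q * m' (y, y')) / (d * m (y, y') ^ 2 - m' (y, y') ^ 2)) • (y, y') +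
      ((q * m (y, y') - p * m' (y, y')) / (d * m (y, y') ^ 2 - m' (y, y') ^ 2)) • (y', d • y), ?_⟩
    refine Prod.ext ?_ ?_
    · change m _ = p
      simp only [map_add, map_smul, smul_eq_mul, e1]
      field_simp
      ring
    · change m' _ = q
      simp only [map_add, map_smul, smul_eq_mul, e2]
      field_simp
      ring
  have hker : LinearMap.range R = LinearMap.ker (m.prod m') := by
    refine Submodule.eq_of_le_of_finrank_eq ?_ ?_
    · rintro _ ⟨x, rfl⟩
      rw [LinearMap.mem_ker]
      refine Prod.ext ?_ ?_
      · exact (hml _ _).trans (h1 x)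
      · exact (hm' _ _).trans (h2 x)
    · have := LinearMap.finrank_range_add_finrank_ker (m.prod m')
      rw [LinearMap.range_eq_top.2 hsurj, finrank_top, Module.finrank_prod, Module.finrank_prod,
        Module.finrank_self] at this
      omega
  intro y y'
  constructor
  · rintro ⟨x, rfl, rfl⟩
    exact ⟨h1 x, h2 x⟩
  · rintro ⟨h, h'⟩
    have : (y, y') ∈ LinearMap.range R := by
      rw [hker, LinearMap.mem_ker]
      exact Prod.ext ((hml _ _).trans h) ((hm' _ _).trans h')
    obtain ⟨x, hx⟩ := this
    exact ⟨x, congrArg Prod.fst hx, congrArg Prod.snd hx⟩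

end Functionals

section PolyFun

variable (k τ : Type*) [Field k]

/-- The algebra of polynomial functions on the affine space `k^τ`. -/
noncomputable def polyFun : Subalgebra k ((τ → k) → k) :=
  (AlgHom.pi fun t => aeval t : MvPolynomial τ k →ₐ[k] _).range

variable {k τ}

lemma mem_polyFun {f : (τ → k) → k} : f ∈ polyFun k τ ↔ ∃ p : MvPolynomial τ k, ∀ t, eval t p = f t :=
  ⟨fun ⟨p, hp⟩ => ⟨p, fun t => congrFun hp t⟩, fun ⟨p, hp⟩ => ⟨p, funext hp⟩⟩

lemma const_mem_polyFun (c : k) : (fun _ => c) ∈ polyFun k τ := (polyFun k τ).algebraMap_mem c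

lemma coord_mem_polyFun (j : τ) : (fun t => t j) ∈ polyFun k τ :=
  mem_polyFun.2 ⟨X j, fun t => by simp⟩

lemma linear_comp_mem_polyFun {κ : Type*} [Fintype κ] (g : (κ → k) →ₗ[k] k)
    {y : (τ → k) → κ → k} (hy : ∀ c, (fun t => y t c) ∈ polyFun k τ) :
    (fun t => g (y t)) ∈ polyFun k τ := by
  classical
  have : (fun t => g (y t)) = ∑ c, g (fun j => if c = j then 1 else 0) • fun t => y t c := by
    ext t
    rw [LinearMap.pi_apply_eq_sum_univ g (y t), Finset.sum_apply]
    exact Finset.sum_congr rfl fun c _ => by rw [Pi.smul_apply, smul_eq_mul, smul_eq_mul, mul_comm]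
  rw [this]
  exact sum_mem fun c _ => (polyFun k τ).smul_mem (hy c) _

end PolyFun

section Chart

variable {k : Type*} [Field k] {n : ℕ}

/-- The two vectors, in coordinates along the basis of a complement of `W`, that span modulo `W` the
plane with coordinates `t` in a standard chart. -/
def chartVec (t : Fin 2 × Fin n → k) (j : Fin 2) : Fin 2 ⊕ Fin n → k :=
  Sum.elim (Pi.single j 1) fun i => t (j, i)

/-- The vectors spanned by the two `chartVec t j`, by equations. -/
def OnChart (t : Fin 2 × Fin n → k) (y : Fin 2 ⊕ Fin n → k) : Prop :=
  ∀ i, y (Sum.inr i) = y (Sum.inl 0) * t (0, i) + y (Sum.inl 1) * t (1, i)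

lemma OnChart.eq_combination {t : Fin 2 × Fin n → k} {y : Fin 2 ⊕ Fin n → k} (h : OnChart t y) :
    y = y (Sum.inl 0) • chartVec t 0 + y (Sum.inl 1) • chartVec t 1 := by
  ext c
  rcases c with j | i
  · fin_cases j <;> simp [chartVec]
  · simpa [chartVec] using h i

lemma onChart_combination (t : Fin 2 × Fin n → k) (a b : k) :
    OnChart t (a • chartVec t 0 + b • chartVec t 1) := by
  intro i
  simp [chartVec]

lemma OnChart.add_smul {t : Fin 2 × Fin n → k} {y z : Fin 2 ⊕ Fin n → k} (hy : OnChart t y)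
    (hz : OnChart t z) (a b : k) : OnChart t (a • y + b • z) := by
  intro i
  simp only [Pi.add_apply, Pi.smul_apply, smul_eq_mul, hy i, hz i]
  ring

variable {ι : Type*} [Fintype ι] [DecidableEq ι]

/-- Let `J² = d` with `d` not a square, and let `F` be a prime cubic form adapted to `J`. Suppose
that `pr` and `pr ∘ J` are jointly injective, for a surjection `pr` onto a space with coordinates
`Fin 2 ⊕ Fin n`. For general `t`, the vectors `x` such that `pr x` and `pr (J x)` both lie in the
plane with chart coordinates `t` form a single orbit under `k(√d)`; a representative can be chosen
polynomial in `t`, and its third point is a birational parametrization of `F = 0`. -/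
theorem exists_chart_parametrization [Infinite k] {F : MvPolynomial ι k}
    (hF3 : F.IsHomogeneous 3) (hF : (Ideal.span {F}).IsPrime) (hF0 : F ≠ 0) {d : k}
    (hd : ∀ c : k, c ^ 2 ≠ d) {J : (ι → k) →ₗ[k] (ι → k)} (hJ : ∀ x, J (J x) = d • x)
    (hFJ : ∀ a b x, eval (quadSMul J a b x) F =
      (a ^ 2 - d * b ^ 2) * (a * eval x F - b * eval (J x) F / d))
    (hι : Fintype.card ι = 2 * n + 2) {pr : (ι → k) →ₗ[k] (Fin 2 ⊕ Fin n → k)}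
    (hpr : Function.Surjective pr) (hinj : ∀ x, pr x = 0 → pr (J x) = 0 → x = 0) :
    ∃ P : ι → MvPolynomial (Fin 2 × Fin n) k,
      IsBirationalParametrization F (thirdPointPoly F d J P) ∧
      ∃ g : MvPolynomial (Fin 2 × Fin n) k, g ≠ 0 ∧ ∀ t, eval t g ≠ 0 →
        ∀ x, x = (fun i => eval t (P i)) → x ≠ 0 ∧
          eval (J x) F ^ 2 ≠ d * (d * eval x F) ^ 2 ∧
          OnChart t (pr x) ∧ OnChart t (pr (J x)) ∧
          ∀ z, OnChart t (pr z) → OnChart t (pr (J z)) → ∃ a b, z = quadSMul J a b x := by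
  have hd0 : d ≠ 0 := fun h => hd 0 (by rw [h]; ring)
  obtain ⟨l₀, l₁, ⟨y₁, hy₁⟩, hl⟩ := exists_functionals hd hJ hpr hinj (by
    rw [Module.finrank_fintype_fun_eq_card, Module.finrank_fintype_fun_eq_card, hι]
    simp; ring)
  have hlx : ∀ x, l₀ (pr x) + l₁ (pr (J x)) = 0 ∧ d * l₁ (pr x) + l₀ (pr (J x)) = 0 :=
    fun x => (hl _ _).1 ⟨x, rfl, rfl⟩
  let y : (Fin 2 × Fin n → k) → Fin 2 ⊕ Fin n → k := fun t =>
    (-l₀ (chartVec t 1)) • chartVec t 0 + l₀ (chartVec t 0) • chartVec t 1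
  let y' : (Fin 2 × Fin n → k) → Fin 2 ⊕ Fin n → k := fun t =>
    (-d * l₁ (chartVec t 1)) • chartVec t 0 + (d * l₁ (chartVec t 0)) • chartVec t 1
  -- a linear left inverse of `(pr, pr ∘ J)` turns `(y, y')` into a vector polynomial in `t`
  obtain ⟨S, hS⟩ := LinearMap.exists_leftInverse_of_injective (pr.prod (pr ∘ₗ J))
    (LinearMap.ker_eq_bot'.2 fun x hx => hinj x (congrArg Prod.fst hx) (congrArg Prod.snd hx))
  have hS' : ∀ x, S (pr x, pr (J x)) = x := fun x => LinearMap.congr_fun hS x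
  have hchart : ∀ j c, (fun t : Fin 2 × Fin n → k => chartVec t j c) ∈ polyFun k (Fin 2 × Fin n) := by
    rintro j (c | i)
    · exact const_mem_polyFun _
    · exact coord_mem_polyFun (j, i)
  have hlchart : ∀ (l : (Fin 2 ⊕ Fin n → k) →ₗ[k] k) j,
      (fun t : Fin 2 × Fin n → k => l (chartVec t j)) ∈ polyFun k (Fin 2 × Fin n) :=
    fun l j => linear_comp_mem_polyFun l (hchart j)
  have hypoly : ∀ c, (fun t => y t c) ∈ polyFun k (Fin 2 × Fin n) := fun c =>
    add_mem (mul_mem (neg_mem (hlchart l₀ 1)) (hchart 0 c)) (mul_mem (hlchart l₀ 0) (hchart 1 c))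
  have hypoly' : ∀ c, (fun t => y' t c) ∈ polyFun k (Fin 2 × Fin n) := fun c =>
    add_mem (mul_mem (mul_mem (const_mem_polyFun (-d)) (hlchart l₁ 1)) (hchart 0 c))
      (mul_mem (mul_mem (const_mem_polyFun d) (hlchart l₁ 0)) (hchart 1 c))
  have hP : ∀ i, ∃ p : MvPolynomial (Fin 2 × Fin n) k, ∀ t, eval t p = S (y t, y' t) i := by
    intro i
    refine mem_polyFun.1 ?_
    have h : (fun t => S (y t, y' t) i) =
        (fun t => (LinearMap.proj i ∘ₗ S ∘ₗ LinearMap.inl k _ _) (y t)) +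
          fun t => (LinearMap.proj i ∘ₗ S ∘ₗ LinearMap.inr k _ _) (y' t) := by
      ext t
      simp only [Pi.add_apply, LinearMap.comp_apply, LinearMap.proj_apply, LinearMap.inl_apply,
        LinearMap.inr_apply]
      rw [← Pi.add_apply, ← map_add, Prod.mk_add_mk, add_zero, zero_add]
    rw [h]
    exact add_mem (linear_comp_mem_polyFun _ hypoly) (linear_comp_mem_polyFun _ hypoly')
  choose P hP using hP
  have hPS : ∀ t, (fun i => eval t (P i)) = S (y t, y' t) := fun t => funext fun i => hP i t
  have hprP : ∀ t, pr (S (y t, y' t)) = y t ∧ pr (J (S (y t, y' t))) = y' t := by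
    intro t
    obtain ⟨x, hx, hx'⟩ := (hl (y t) (y' t)).2 (by
      simp only [y, y', map_add, map_smul, smul_eq_mul]
      constructor <;> ring)
    rw [← hx, ← hx', hS']
    exact ⟨rfl, rfl⟩
  have hchy : ∀ t, OnChart t (y t) := fun t => onChart_combination t _ _
  have hchy' : ∀ t, OnChart t (y' t) := fun t => onChart_combination t _ _
  let u : Fin 2 ⊕ Fin n → (ι → k) →ₗ[k] k := fun c => LinearMap.proj c ∘ₗ pr
  have hu : ∀ c x, u c x = pr x c := fun _ _ => rfl
  let D := wedgeForm J (u (Sum.inl 0)) (u (Sum.inl 1))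
  let Q : Fin 2 × Fin n → MvPolynomial ι k := fun ji =>
    if ji.1 = 0 then wedgeForm J (u (Sum.inr ji.2)) (u (Sum.inl 1))
    else wedgeForm J (u (Sum.inl 0)) (u (Sum.inr ji.2))
  have hQ0 : ∀ i, Q (0, i) = wedgeForm J (u (Sum.inr i)) (u (Sum.inl 1)) := fun i => rfl
  have hQ1 : ∀ i, Q (1, i) = wedgeForm J (u (Sum.inl 0)) (u (Sum.inr i)) := fun i => rfl
  have hD2 : D.IsHomogeneous 2 := isHomogeneous_wedgeForm _ _
  have hDJ : ∀ a b x, eval (quadSMul J a b x) D = (a ^ 2 - d * b ^ 2) * eval x D := fun a b x =>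
    eval_wedgeForm_quadSMul hJ _ _ a b x
  have hDx : ∀ x, eval x D = pr x (Sum.inl 0) * pr (J x) (Sum.inl 1) -
      pr (J x) (Sum.inl 0) * pr x (Sum.inl 1) := fun x => by simp [D, hu]
  have hD0 : D ≠ 0 := by
    intro h
    have hDz : ∀ x, pr x (Sum.inl 0) * pr (J x) (Sum.inl 1) -
        pr (J x) (Sum.inl 0) * pr x (Sum.inl 1) = 0 := fun x => by rw [← hDx, h, map_zero]
    obtain ⟨x, hx⟩ := hpr (Pi.single (Sum.inl 0) 1)
    obtain ⟨z, hz⟩ := hpr (Pi.single (Sum.inl 1) 1)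
    -- polarizing the vanishing form at `x`, `z` and `J z` exhibits `d` as a square
    have e1 := hDz x
    have e2 := hDz z
    have e3 := hDz (x + z)
    have e4 := hDz (x + J z)
    simp only [map_add, hJ, map_smul, Pi.add_apply, Pi.smul_apply, smul_eq_mul, hx, hz,
      Pi.single_eq_same, ne_eq, Sum.inl.injEq, zero_ne_one, one_ne_zero, not_false_eq_true,
      Pi.single_eq_of_ne, zero_mul, mul_zero, one_mul, mul_one, add_zero, zero_add, sub_zero,
      zero_sub, neg_eq_zero] at e1 e2 e3 e4
    refine hd (pr (J x) (Sum.inl 0)) ?_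
    rw [e1, e2] at e3
    rw [e1, e2] at e4
    linear_combination -e4 - (pr (J x) (Sum.inl 0)) * e3
  have hbir : IsBirationalParametrization F (thirdPointPoly F d J P) := by
    refine isBirationalParametrization_thirdPointPoly hF3 hF hd0 hJ hFJ
      (compForm_notMem_span hF3 hF0 hJ hd) P D Q hD2 hD0
      (forall_fin_two_prod (fun i => isHomogeneous_wedgeForm _ _) fun i => isHomogeneous_wedgeForm _ _) hDJ
      (forall_fin_two_prod (fun i a b x => eval_wedgeForm_quadSMul hJ _ _ a b x)
        fun i a b x => eval_wedgeForm_quadSMul hJ _ _ a b x) ?_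
      (C d * linForm (l₁ ∘ₗ pr) ^ 2 - linForm (l₁ ∘ₗ pr ∘ₗ J) ^ 2) ?_ ?_
    · intro t
      have h0 := hchy t
      have h1 := hchy' t
      rw [hPS, hDx]
      refine forall_fin_two_prod (fun i => ?_) fun i => ?_
      · rw [hQ0, eval_wedgeForm]
        simp only [hu, (hprP t).1, (hprP t).2, h0 i, h1 i]
        ring
      · rw [hQ1, eval_wedgeForm]
        simp only [hu, (hprP t).1, (hprP t).2, h0 i, h1 i]
        ring
    · intro h
      obtain ⟨x, rfl⟩ := hpr y₁
      have h1 := congrArg (eval x) h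
      simp only [map_sub, map_mul, map_pow, eval_C, eval_linForm, LinearMap.comp_apply,
        map_zero] at h1
      refine hd (l₁ (pr (J x)) / l₁ (pr x)) ?_
      field_simp
      linear_combination -h1
    · intro x hDx0 hM
      simp only [map_sub, map_mul, map_pow, eval_C, eval_linForm, LinearMap.comp_apply] at hM
      set Δ := eval x D with hΔ
      rw [hDx] at hΔ
      obtain ⟨hx0, hx1⟩ := hlx x
      set v := pr x
      set v' := pr (J x)
      let t : Fin 2 × Fin n → k := fun j => eval x (Q j) / Δ
      have hf0 : chartVec t 0 = (v' (Sum.inl 1) / Δ) • v - (v (Sum.inl 1) / Δ) • v' := by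
        ext c
        rcases c with j | i
        · fin_cases j
          · simp only [chartVec, Sum.elim_inl, Pi.sub_apply, Pi.smul_apply, smul_eq_mul]
            simp
            field_simp
            linear_combination hΔ
          · simp only [chartVec, Sum.elim_inl, Pi.sub_apply, Pi.smul_apply, smul_eq_mul]
            simp
            ring
        · simp only [chartVec, Sum.elim_inr, Pi.sub_apply, Pi.smul_apply, smul_eq_mul, t, hQ0,
            eval_wedgeForm, hu]
          ring
      have hf1 : chartVec t 1 = (v (Sum.inl 0) / Δ) • v' - (v' (Sum.inl 0) / Δ) • v := by
        ext c
        rcases c with j | i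
        · fin_cases j
          · simp only [chartVec, Sum.elim_inl, Pi.sub_apply, Pi.smul_apply, smul_eq_mul]
            simp
            ring
          · simp only [chartVec, Sum.elim_inl, Pi.sub_apply, Pi.smul_apply, smul_eq_mul]
            simp
            field_simp
            linear_combination hΔ
        · simp only [chartVec, Sum.elim_inr, Pi.sub_apply, Pi.smul_apply, smul_eq_mul, t, hQ1,
            eval_wedgeForm, hu]
          ring
      have e0 : l₀ v = -l₁ v' := eq_neg_of_add_eq_zero_left hx0
      have e1 : l₀ v' = -(d * l₁ v) := eq_neg_of_add_eq_zero_right hx1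
      refine ⟨t, d * l₁ v / Δ, -l₁ v' / Δ, ?_, ?_⟩
      · have : (d * l₁ v / Δ) ^ 2 - d * (-l₁ v' / Δ) ^ 2 =
            d * (d * l₁ v ^ 2 - l₁ v' ^ 2) / Δ ^ 2 := by
          field_simp
        rw [this]
        exact div_ne_zero (mul_ne_zero hd0 hM) (pow_ne_zero _ hDx0)
      · rw [hPS, ← hS' (quadSMul J _ _ x), map_quadSMul hJ]
        congr 2
        · ext c
          simp only [y, hf0, hf1, quadSMul, map_sub, map_add, map_smul, smul_eq_mul, e0, e1,
            Pi.add_apply, Pi.sub_apply, Pi.smul_apply]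
          change _ = d * l₁ v / Δ * v c + -l₁ v' / Δ * v' c
          field_simp
          rw [hΔ]
          ring
        · ext c
          simp only [y', hf0, hf1, quadSMul, map_sub, map_add, map_smul, smul_eq_mul,
            Pi.add_apply, Pi.sub_apply, Pi.smul_apply]
          change _ = d * (-l₁ v' / Δ) * v c + d * l₁ v / Δ * v' c
          field_simp
          rw [hΔ]
          ring
  refine ⟨P, hbir, aeval (thirdPointPoly F d J P) D, ?_, ?_⟩
  · exact hbir.2.2.1 2 D hD2 (notMem_span_of_isHomogeneous_of_lt hF3 hD2 (by norm_num) hD0)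
  · intro t ht x hx
    rw [eval_aeval, eval_thirdPointPoly, ← hx, thirdPoint_eq_quadSMul, hDJ] at ht
    have hN := left_ne_zero_of_mul ht
    have hDx0 := right_ne_zero_of_mul ht
    rw [hPS] at hx
    have hxy : pr x = y t := by rw [hx]; exact (hprP t).1
    have hxy' : pr (J x) = y' t := by rw [hx]; exact (hprP t).2
    refine ⟨?_, fun h => hN (by rw [h]; ring), ?_, ?_, ?_⟩
    · intro h0
      exact hDx0 (by rw [hDx, h0]; simp)
    · rw [hxy]; exact hchy t
    · rw [hxy']; exact hchy' t
    intro z hz hz'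
    rw [hDx] at hDx0
    set v := pr x
    set v' := pr (J x)
    have hv : OnChart t v := by rw [hxy]; exact hchy t
    have hv' : OnChart t v' := by rw [hxy']; exact hchy' t
    set Δ := v (Sum.inl 0) * v' (Sum.inl 1) - v' (Sum.inl 0) * v (Sum.inl 1) with hΔ
    set a := (pr z (Sum.inl 0) * v' (Sum.inl 1) - pr z (Sum.inl 1) * v' (Sum.inl 0)) / Δ with ha
    set b := (pr z (Sum.inl 1) * v (Sum.inl 0) - pr z (Sum.inl 0) * v (Sum.inl 1)) / Δ with hb
    refine ⟨a, b, ?_⟩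
    rw [← sub_eq_zero]
    set w := z - quadSMul J a b x with hw
    have hprw : pr w = (1 : k) • pr z + (-1 : k) • (a • v + b • v') := by
      simp only [hw, quadSMul, map_sub, map_add, map_smul]
      module
    have hprw' : pr (J w) = (1 : k) • pr (J z) + (-1 : k) • ((d * b) • v + a • v') := by
      rw [hw, map_sub, map_quadSMul hJ]
      simp only [quadSMul, map_sub, map_add, map_smul]
      module
    have hcw : OnChart t (pr w) := by rw [hprw]; exact hz.add_smul (hv.add_smul hv' _ _) _ _
    have hcw' : OnChart t (pr (J w)) := by rw [hprw']; exact hz'.add_smul (hv.add_smul hv' _ _) _ _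
    have hw0 : pr w = 0 := by
      rw [hcw.eq_combination]
      have h0 : pr w (Sum.inl 0) = 0 := by
        rw [hprw]
        simp only [Pi.add_apply, Pi.smul_apply, smul_eq_mul, ha, hb]
        field_simp
        rw [hΔ]
        ring
      have h1 : pr w (Sum.inl 1) = 0 := by
        rw [hprw]
        simp only [Pi.add_apply, Pi.smul_apply, smul_eq_mul, ha, hb]
        field_simp
        rw [hΔ]
        ring
      rw [h0, h1, zero_smul, zero_smul, add_zero]
    -- `pr (J w)` lies in the plane and is killed by both functionals, which are independent on it
    have hΔl : Δ = d * (l₀ (chartVec t 0) * l₁ (chartVec t 1) -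
        l₀ (chartVec t 1) * l₁ (chartVec t 0)) := by
      rw [hΔ, hxy, hxy']
      simp [y, y', chartVec]
      ring
    have hlw := hlx w
    rw [hw0, map_zero, map_zero, mul_zero, zero_add, zero_add] at hlw
    obtain ⟨k1, k0⟩ := hlw
    have hcomb := hcw'.eq_combination
    set r := pr (J w) (Sum.inl 0)
    set s := pr (J w) (Sum.inl 1)
    rw [hcomb, map_add, map_smul, map_smul, smul_eq_mul, smul_eq_mul] at k0 k1
    have hr : r = 0 := by
      have : r * Δ = 0 := by
        rw [hΔl]
        linear_combination d * l₁ (chartVec t 1) * k0 - d * l₀ (chartVec t 1) * k1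
      exact (mul_eq_zero.1 this).resolve_right hDx0
    have hs : s = 0 := by
      have : s * Δ = 0 := by
        rw [hΔl]
        linear_combination d * l₀ (chartVec t 0) * k1 - d * l₁ (chartVec t 0) * k0
      exact (mul_eq_zero.1 this).resolve_right hDx0
    refine hinj w hw0 ?_
    rw [hcomb, hr, hs, zero_smul, zero_smul, add_zero]

end Chart

/-! ### Quadratic extensions -/

section QuadraticExtension

variable {k L : Type*} [Field k] [Field L] [Algebra k L]

/-- A presentation `L = k(√d)` of a quadratic extension, with `σ` acting by `√d ↦ -√d`. -/
structure QuadraticPresentation (σ : L ≃ₐ[k] L) where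
  /-- The square root that generates `L`. -/
  δ : L
  /-- The square of the generator. -/
  d : k
  /-- The coefficient of `1`. -/
  re : L →ₗ[k] k
  /-- The coefficient of the generator. -/
  im : L →ₗ[k] k
  δ_sq : δ ^ 2 = algebraMap k L d
  map_δ : σ δ = -δ
  eq_re_add_im : ∀ z, z = algebraMap k L (re z) + δ * algebraMap k L (im z)
  re_mk : ∀ a b, re (algebraMap k L a + δ * algebraMap k L b) = a
  im_mk : ∀ a b, im (algebraMap k L a + δ * algebraMap k L b) = b

lemma nonempty_quadraticPresentation [CharZero k] (h2 : Module.finrank k L = 2) {σ : L ≃ₐ[k] L}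
    (hσ : σ ≠ AlgEquiv.refl) : Nonempty (QuadraticPresentation σ) := by
  have : FiniteDimensional k L := Module.finite_of_finrank_pos (by omega)
  have : CharZero L := charZero_of_injective_algebraMap (algebraMap k L).injective
  have hσσ : ∀ z, σ (σ z) = z := by
    have h1 : orderOf σ ≤ 2 := by
      rw [← h2]
      exact orderOf_le_card_univ.trans AlgEquiv.card_le
    have h3 : orderOf σ ≠ 1 := fun h => hσ (orderOf_eq_one_iff.1 h)
    have h4 := orderOf_pos σ
    have h5 : σ ^ 2 = 1 := by
      rw [← orderOf_dvd_iff_pow_eq_one]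
      exact dvd_of_eq (by omega)
    intro z
    have := AlgEquiv.congr_fun h5 z
    rwa [pow_two] at this
  obtain ⟨z, hz⟩ : ∃ z, σ z ≠ z := by
    by_contra! h
    exact hσ (AlgEquiv.ext h)
  set δ := z - σ z with hδ
  have hδ0 : δ ≠ 0 := sub_ne_zero.2 hz.symm
  have hmap : σ δ = -δ := by rw [hδ, map_sub, hσσ]; ring
  have hind : ∀ a b : k, algebraMap k L a + δ * algebraMap k L b = 0 → a = 0 ∧ b = 0 := by
    intro a b h
    have h' := congrArg σ h
    rw [map_add, map_mul, AlgEquiv.commutes, AlgEquiv.commutes, hmap, map_zero] at h'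
    have ha : algebraMap k L a = 0 := by
      have : (2 : L) * algebraMap k L a = 0 := by linear_combination h + h'
      exact (mul_eq_zero.1 this).resolve_left two_ne_zero
    rw [ha, zero_add] at h
    exact ⟨(map_eq_zero _).1 ha, (map_eq_zero _).1 ((mul_eq_zero.1 h).resolve_left hδ0)⟩
  have hli : LinearIndependent k ![(1 : L), δ] := by
    rw [LinearIndependent.pair_iff]
    intro a b h
    refine hind a b ?_
    rw [← h, Algebra.smul_def, Algebra.smul_def]
    ring
  let B := basisOfLinearIndependentOfCardEqFinrank hli (by rw [h2, Fintype.card_fin])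
  have hB : ⇑B = ![(1 : L), δ] := coe_basisOfLinearIndependentOfCardEqFinrank _ _
  have hdec : ∀ w, w = algebraMap k L (B.coord 0 w) + δ * algebraMap k L (B.coord 1 w) := by
    intro w
    conv_lhs => rw [← B.sum_repr w]
    rw [Fin.sum_univ_two, hB, Algebra.smul_def, Algebra.smul_def]
    simp
    ring
  have hmk : ∀ a b, B.coord 0 (algebraMap k L a + δ * algebraMap k L b) = a ∧
      B.coord 1 (algebraMap k L a + δ * algebraMap k L b) = b := by
    intro a b
    have h := hdec (algebraMap k L a + δ * algebraMap k L b)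
    have := hind (B.coord 0 (algebraMap k L a + δ * algebraMap k L b) - a)
      (B.coord 1 (algebraMap k L a + δ * algebraMap k L b) - b)
      (by rw [map_sub, map_sub]; linear_combination -h)
    exact ⟨sub_eq_zero.1 this.1, sub_eq_zero.1 this.2⟩
  have hsq : δ ^ 2 = algebraMap k L (B.coord 0 (δ ^ 2)) := by
    have h := hdec (δ ^ 2)
    have h' := congrArg σ h
    rw [map_add, map_mul, AlgEquiv.commutes, AlgEquiv.commutes, map_pow, hmap] at h'
    have : (2 : L) * δ ^ 2 = 2 * algebraMap k L (B.coord 0 (δ ^ 2)) := by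
      linear_combination h + h'
    exact mul_left_cancel₀ two_ne_zero this
  exact ⟨⟨δ, _, B.coord 0, B.coord 1, hsq, hmap, hdec, fun a b => (hmk a b).1,
    fun a b => (hmk a b).2⟩⟩

end QuadraticExtension

/-! ### Conjugate subspaces as eigenspaces -/

namespace QuadraticPresentation

variable {k L : Type*} [Field k] [Field L] [Algebra k L] {σ : L ≃ₐ[k] L}
  (q : QuadraticPresentation σ)

lemma eq_zero_of_add_eq_zero {a b : k} (h : algebraMap k L a + q.δ * algebraMap k L b = 0) :
    a = 0 ∧ b = 0 := by
  constructor
  · rw [← q.re_mk a b, h, map_zero]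
  · rw [← q.im_mk a b, h, map_zero]

lemma δ_ne_zero : q.δ ≠ 0 := by
  intro h
  have := q.eq_zero_of_add_eq_zero (a := 0) (b := 1) (by rw [h]; simp)
  exact one_ne_zero this.2

lemma sq_ne_d (c : k) : c ^ 2 ≠ q.d := by
  intro h
  have h1 : (q.δ - algebraMap k L c) * (q.δ + algebraMap k L c) = 0 := by
    have := q.δ_sq
    rw [← h, map_pow] at this
    linear_combination this
  rcases mul_eq_zero.1 h1 with h | h
  · have := q.eq_zero_of_add_eq_zero (a := -c) (b := 1) (by
      rw [map_neg, map_one]; linear_combination h)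
    exact one_ne_zero this.2
  · have := q.eq_zero_of_add_eq_zero (a := c) (b := 1) (by
      rw [map_one]; linear_combination h)
    exact one_ne_zero this.2

lemma d_ne_zero : q.d ≠ 0 := fun h => q.sq_ne_d 0 (by rw [h]; ring)

lemma map_eq (z : L) : σ z = algebraMap k L (q.re z) + q.δ * algebraMap k L (-q.im z) := by
  conv_lhs => rw [q.eq_re_add_im z]
  rw [map_add, map_mul, AlgEquiv.commutes, AlgEquiv.commutes, q.map_δ, map_neg]
  ring

lemma re_map (z : L) : q.re (σ z) = q.re z := by rw [q.map_eq, q.re_mk]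

lemma im_map (z : L) : q.im (σ z) = -q.im z := by rw [q.map_eq, q.im_mk]

lemma map_map (q : QuadraticPresentation σ) (z : L) : σ (σ z) = z := by
  rw [q.map_eq (σ z), q.re_map, q.im_map, neg_neg, ← q.eq_re_add_im]

lemma re_mul (s z : L) : q.re (s * z) = q.re s * q.re z + q.d * (q.im s * q.im z) := by
  conv_lhs => rw [q.eq_re_add_im s, q.eq_re_add_im z]
  rw [← q.re_mk (q.re s * q.re z + q.d * (q.im s * q.im z)) (q.re s * q.im z + q.im s * q.re z)]
  congr 1
  simp only [map_add, map_mul, ← q.δ_sq]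
  ring

lemma im_mul (s z : L) : q.im (s * z) = q.re s * q.im z + q.im s * q.re z := by
  conv_lhs => rw [q.eq_re_add_im s, q.eq_re_add_im z]
  rw [← q.im_mk (q.re s * q.re z + q.d * (q.im s * q.im z)) (q.re s * q.im z + q.im s * q.re z)]
  congr 1
  simp only [map_add, map_mul, ← q.δ_sq]
  ring

variable {ι : Type*}

/-- The vector over `k` of the coefficients of `1`. -/
def reVec : (ι → L) →ₗ[k] (ι → k) := q.re.compLeft ι

/-- The vector over `k` of the coefficients of the generator. -/
def imVec : (ι → L) →ₗ[k] (ι → k) := q.im.compLeft ι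

@[simp] lemma reVec_apply (v : ι → L) (i : ι) : q.reVec v i = q.re (v i) := rfl

@[simp] lemma imVec_apply (v : ι → L) (i : ι) : q.imVec v i = q.im (v i) := rfl

/-- The vector over `L` with given components over `k`. -/
def mkVec (x y : ι → k) : ι → L := extVec L x + q.δ • extVec L y

lemma mkVec_apply (x y : ι → k) (i : ι) :
    q.mkVec x y i = algebraMap k L (x i) + q.δ * algebraMap k L (y i) := rfl

lemma eq_mkVec (v : ι → L) : v = q.mkVec (q.reVec v) (q.imVec v) :=
  funext fun i => q.eq_re_add_im (v i)

@[simp] lemma reVec_mkVec (x y : ι → k) : q.reVec (q.mkVec x y) = x :=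
  funext fun i => q.re_mk (x i) (y i)

@[simp] lemma imVec_mkVec (x y : ι → k) : q.imVec (q.mkVec x y) = y :=
  funext fun i => q.im_mk (x i) (y i)

lemma reVec_smul (s : L) (v : ι → L) :
    q.reVec (s • v) = q.re s • q.reVec v + (q.d * q.im s) • q.imVec v :=
  funext fun i => by simp [q.re_mul]; ring

lemma imVec_smul (s : L) (v : ι → L) :
    q.imVec (s • v) = q.re s • q.imVec v + q.im s • q.reVec v :=
  funext fun i => by simp [q.im_mul]

lemma re_δ : q.re q.δ = 0 := by simpa using q.re_mk 0 1

lemma im_δ : q.im q.δ = 1 := by simpa using q.im_mk 0 1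

lemma mem_extSpace {W : Submodule k (ι → k)} {v : ι → L} :
    v ∈ extSpace L W ↔ q.reVec v ∈ W ∧ q.imVec v ∈ W := by
  constructor
  · intro h
    induction h using Submodule.span_induction with
    | mem x hx =>
      obtain ⟨w, hw, rfl⟩ := hx
      have : extVec L w = q.mkVec w 0 := funext fun i => by simp [mkVec_apply, extVec]
      rw [this, reVec_mkVec, imVec_mkVec]
      exact ⟨hw, W.zero_mem⟩
    | zero => simp
    | add x y _ _ hx hy =>
      rw [map_add, map_add]
      exact ⟨W.add_mem hx.1 hy.1, W.add_mem hx.2 hy.2⟩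
    | smul s x _ hx =>
      rw [reVec_smul, imVec_smul]
      exact ⟨W.add_mem (W.smul_mem _ hx.1) (W.smul_mem _ hx.2),
        W.add_mem (W.smul_mem _ hx.2) (W.smul_mem _ hx.1)⟩
  · rintro ⟨h1, h2⟩
    rw [q.eq_mkVec v]
    exact Submodule.add_mem _ (Submodule.subset_span ⟨_, h1, rfl⟩)
      (Submodule.smul_mem _ _ (Submodule.subset_span ⟨_, h2, rfl⟩))

lemma reVec_conj (v : ι → L) : q.reVec (fun i => σ (v i)) = q.reVec v :=
  funext fun i => q.re_map (v i)

lemma imVec_conj (v : ι → L) : q.imVec (fun i => σ (v i)) = -q.imVec v :=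
  funext fun i => q.im_map (v i)

/-- Two conjugate complementary subspaces `H₁`, `H₂` of `L^ι` are the eigenspaces of an operator `J`
over `k` with `J² = d`. -/
lemma exists_operator [Fintype ι] {n : ℕ} (h2 : Module.finrank k L = 2)
    (hι : Fintype.card ι = 2 * n + 2) {H₁ H₂ : Submodule L (ι → L)}
    (hH₁ : Module.finrank L H₁ = n + 1) (hconj : IsConjugateBy σ H₁ H₂) (hdisj : Disjoint H₁ H₂) :
    ∃ J : (ι → k) →ₗ[k] (ι → k), (∀ x, J (J x) = q.d • x) ∧
      (∀ v, v ∈ H₁ ↔ q.reVec v = J (q.imVec v)) ∧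
      (∀ v, v ∈ H₂ ↔ q.reVec v = -J (q.imVec v)) := by
  have hrat : ∀ v ∈ H₁, q.imVec v = 0 → v = 0 := by
    intro v hv h
    have hv2 := (hconj v).1 hv
    have : (fun i => σ (v i)) = v := by
      rw [q.eq_mkVec fun i => σ (v i), reVec_conj, imVec_conj, h, neg_zero, ← h, ← q.eq_mkVec]
    rw [this] at hv2
    exact Submodule.disjoint_def.1 hdisj v hv hv2
  let f : H₁ →ₗ[k] (ι → k) := q.imVec ∘ₗ (H₁.subtype.restrictScalars k)
  have hf : Function.Injective f := by
    rw [injective_iff_map_eq_zero]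
    intro v hv
    exact Subtype.ext (hrat v v.2 hv)
  have : FiniteDimensional k L := Module.finite_of_finrank_pos (by omega)
  have : FiniteDimensional k H₁ := Module.Finite.trans L H₁
  have hdim : Module.finrank k H₁ = Module.finrank k (ι → k) := by
    rw [← Module.finrank_mul_finrank k L H₁, h2, hH₁, Module.finrank_fintype_fun_eq_card, hι]
    ring
  let e : H₁ ≃ₗ[k] (ι → k) := LinearMap.linearEquivOfInjective f hf hdim
  have he : ∀ v : H₁, e v = q.imVec (v : ι → L) := fun v => rfl
  let J : (ι → k) →ₗ[k] (ι → k) :=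
    (q.reVec ∘ₗ (H₁.subtype.restrictScalars k)) ∘ₗ e.symm.toLinearMap
  have hJe : ∀ x, J x = q.reVec ((e.symm x : H₁) : ι → L) := fun x => rfl
  have him : ∀ x, q.imVec ((e.symm x : H₁) : ι → L) = x := fun x => by
    rw [← he, LinearEquiv.apply_symm_apply]
  have hmem : ∀ v, v ∈ H₁ ↔ q.reVec v = J (q.imVec v) := by
    intro v
    constructor
    · intro hv
      rw [hJe, ← he ⟨v, hv⟩, LinearEquiv.symm_apply_apply]
    · intro h
      rw [q.eq_mkVec v, h, hJe]
      nth_rewrite 2 [← him (q.imVec v)]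
      rw [← q.eq_mkVec]
      exact Subtype.mem _
  refine ⟨J, ?_, hmem, ?_⟩
  · intro x
    have h1 : q.mkVec (J x) x ∈ H₁ := (hmem _).2 (by simp)
    have h3 := (hmem _).1 (H₁.smul_mem q.δ h1)
    rw [reVec_smul, imVec_smul, re_δ, im_δ] at h3
    simpa using h3.symm
  · intro v
    have h1 := hconj fun i => σ (v i)
    simp only [q.map_map] at h1
    rw [← h1, hmem, reVec_conj, imVec_conj, map_neg]

/-- A cubic form that vanishes on the eigenvectors `J x + δ x` takes on the pencil spanned by `x` and
`J x` the value given by a product of three linear forms, the first two of which vanish at the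
eigenvectors `J x ± δ x`. -/
lemma aeval_pencil {F : MvPolynomial ι k} (hF3 : F.IsHomogeneous 3)
    {J : (ι → k) →ₗ[k] (ι → k)} (hF : ∀ x, aeval (q.mkVec (J x) x) F = 0) (x : ι → k) (α β : L) :
    aeval (α • extVec L x + β • extVec L (J x)) F =
      (α ^ 2 - algebraMap k L q.d * β ^ 2) *
        (α * algebraMap k L (eval x F) - β * algebraMap k L (eval (J x) F / q.d)) := by
  obtain ⟨c, c', hc⟩ := exists_aeval_combination_of_isHomogeneous_three L hF3 x (J x)
  have hα : ∀ α β : L, aeval (α • extVec L x + β • extVec L (J x)) F = _ := hc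
  simp only [aeval_eq_eval] at hα
  have h0 := hα q.δ 1
  have h1 : q.δ • extVec L x + (1 : L) • extVec L (J x) = q.mkVec (J x) x := by
    rw [one_smul, add_comm]; rfl
  rw [h1, hF] at h0
  have hδ3 : q.δ ^ 3 = q.δ * algebraMap k L q.d := by rw [← q.δ_sq]; ring
  rw [hδ3, q.δ_sq] at h0
  obtain ⟨e1, e2⟩ := q.eq_zero_of_add_eq_zero (a := eval (J x) F + q.d * c)
    (b := q.d * eval x F + c') (by
      simp only [map_add, map_mul]
      linear_combination -h0)
  have hc1 : c = -(eval (J x) F / q.d) := by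
    have := q.d_ne_zero
    field_simp
    linear_combination e1
  have hc2 : c' = -(q.d * eval x F) := by linear_combination e2
  have hJF : eval (J x) F = q.d * (eval (J x) F / q.d) := by
    rw [mul_div_cancel₀ _ q.d_ne_zero]
  rw [hα, hc1, hc2]
  nth_rewrite 2 [hJF]
  simp only [map_neg, map_mul]
  ring

lemma eval_quadSMul {F : MvPolynomial ι k} (hF3 : F.IsHomogeneous 3)
    {J : (ι → k) →ₗ[k] (ι → k)} (hF : ∀ x, aeval (q.mkVec (J x) x) F = 0) (a b : k) (x : ι → k) :
    eval (quadSMul J a b x) F =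
      (a ^ 2 - q.d * b ^ 2) * (a * eval x F - b * eval (J x) F / q.d) := by
  have h := q.aeval_pencil hF3 hF x (algebraMap k L a) (algebraMap k L b)
  have h1 : algebraMap k L a • extVec L x + algebraMap k L b • extVec L (J x) =
      fun i => algebraMap k L (quadSMul J a b x i) := funext fun i => by
    simp [quadSMul, extVec, Algebra.smul_def]
  have h2 : aeval (fun i => algebraMap k L (quadSMul J a b x i)) F =
      algebraMap k L (aeval (quadSMul J a b x) F) := by
    rw [← MvPolynomial.aeval_algebraMap_apply]
    rfl
  rw [h1, h2, aeval_eq_eval] at h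
  apply (algebraMap k L).injective
  refine Eq.trans h ?_
  rw [← mul_div_assoc']
  simp only [map_mul, map_sub, map_pow]

end QuadraticPresentation

/-! ### Planes of the Grassmannian and the third intersection point -/

section ChartPlane

variable {k V : Type*} [Field k] [AddCommGroup V] [Module k V] {n : ℕ}

/-- The coordinates modulo `W` along a basis of a complement of `W`. -/
lemma exists_coordinates {κ : Type*} [Fintype κ] {W : Submodule k V} {e : κ → V}
    (he : LinearIndependent k e) (hW : IsCompl W (Submodule.span k (Set.range e))) :
    ∃ pr : V →ₗ[k] (κ → k), (∀ x, pr x = 0 ↔ x ∈ W) ∧ ∀ y : κ → k, pr (∑ c, y c • e c) = y := by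
  let b := Module.Basis.span he
  let π := Submodule.projectionOnto _ _ hW.symm
  refine ⟨b.equivFun.toLinearMap ∘ₗ π, fun x => ?_, fun y => ?_⟩
  · rw [LinearMap.comp_apply, LinearEquiv.coe_coe, LinearEquiv.map_eq_zero_iff,
      Submodule.projectionOnto_apply_eq_zero_iff]
  · have h1 : ∑ c, y c • e c = ((∑ c, y c • b c : Submodule.span k (Set.range e)) : V) := by
      rw [Submodule.coe_sum]
      exact Finset.sum_congr rfl fun c _ => by
        rw [Submodule.coe_smul, Module.Basis.span_apply he]
    rw [LinearMap.comp_apply, h1, Submodule.projectionOnto_apply_left, LinearEquiv.coe_coe,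
      ← b.equivFun_symm_apply, LinearEquiv.apply_symm_apply]

lemma mem_chartPlane_iff {W : Submodule k V} {e : Fin 2 ⊕ Fin n → V}
    {pr : V →ₗ[k] (Fin 2 ⊕ Fin n → k)} (hW : ∀ x, pr x = 0 ↔ x ∈ W)
    (he : ∀ y, pr (∑ c, y c • e c) = y) (t : Fin 2 × Fin n → k) (x : V) :
    x ∈ chartPlane W e t ↔ OnChart t (pr x) := by
  have hf : ∀ j, pr (e (Sum.inl j) + ∑ i : Fin n, t (j, i) • e (Sum.inr i)) = chartVec t j := by
    intro j
    rw [← he (chartVec t j), Fintype.sum_sum_type]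
    congr 2
    simp [chartVec, Pi.single_apply]
  constructor
  · intro h
    obtain ⟨w, hw, s, hs, rfl⟩ := Submodule.mem_sup.1 h
    obtain ⟨c, rfl⟩ := (Submodule.mem_span_range_iff_exists_fun k).1 hs
    rw [map_add, (hW w).2 hw, zero_add, Fin.sum_univ_two, map_add, map_smul, map_smul, hf, hf]
    exact onChart_combination t _ _
  · intro h
    set s := pr x (Sum.inl 0) • (e (Sum.inl 0) + ∑ i : Fin n, t (0, i) • e (Sum.inr i)) +
      pr x (Sum.inl 1) • (e (Sum.inl 1) + ∑ i : Fin n, t (1, i) • e (Sum.inr i)) with hs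
    have h1 : x - s ∈ W := by
      rw [← hW, map_sub, hs, map_add, map_smul, map_smul, hf, hf, ← h.eq_combination, sub_self]
    have h2 : s ∈ Submodule.span k (Set.range fun j : Fin 2 =>
        e (Sum.inl j) + ∑ i : Fin n, t (j, i) • e (Sum.inr i)) :=
      Submodule.add_mem _ (Submodule.smul_mem _ _ (Submodule.subset_span ⟨0, rfl⟩))
        (Submodule.smul_mem _ _ (Submodule.subset_span ⟨1, rfl⟩))
    rw [← sub_add_cancel x s]
    exact Submodule.add_mem_sup h1 h2

end ChartPlane

namespace QuadraticPresentation

variable {k L ι : Type*} [Field k] [Field L] [Algebra k L] {σ : L ≃ₐ[k] L}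
  (q : QuadraticPresentation σ)

lemma vec_ext {v w : ι → L} (h1 : q.reVec v = q.reVec w) (h2 : q.imVec v = q.imVec w) : v = w := by
  rw [q.eq_mkVec v, q.eq_mkVec w, h1, h2]

lemma conj_mkVec (x y : ι → k) : (fun i => σ (q.mkVec x y i)) = q.mkVec x (-y) :=
  q.vec_ext (by rw [reVec_conj, reVec_mkVec, reVec_mkVec])
    (by rw [imVec_conj, imVec_mkVec, imVec_mkVec])

variable {J : (ι → k) →ₗ[k] (ι → k)}

lemma quadSMul_eq_zero (hJ : ∀ x, J (J x) = q.d • x) {a b : k} {x : ι → k} (hx : x ≠ 0)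
    (h : quadSMul J a b x = 0) : a = 0 ∧ b = 0 := by
  have h1 : (a ^ 2 - q.d * b ^ 2) • x = 0 := by
    have h2 := congrArg (quadSMul J a (-b)) h
    simp only [quadSMul, map_add, map_smul, hJ, map_zero, smul_zero, add_zero] at h2
    rw [← h2]
    module
  have h2 := (smul_eq_zero.1 h1).resolve_right hx
  have hb : b = 0 := by
    by_contra hb
    refine q.sq_ne_d (a / b) ?_
    field_simp
    linear_combination h2
  rw [hb] at h2
  exact ⟨by simpa using h2, hb⟩

lemma disjoint_extSpace_iff {W : Submodule k (ι → k)} {H : Submodule L (ι → L)}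
    (hH : ∀ v, v ∈ H ↔ q.reVec v = J (q.imVec v)) :
    Disjoint (extSpace L W) H ↔ ∀ w ∈ W, J w ∈ W → w = 0 := by
  rw [Submodule.disjoint_def]
  constructor
  · intro h w hw hJw
    have := h (q.mkVec (J w) w) (q.mem_extSpace.2 (by simpa using ⟨hJw, hw⟩)) ((hH _).2 (by simp))
    rw [← q.imVec_mkVec (J w) w, this, map_zero]
  · intro h v hv hvH
    obtain ⟨h1, h2⟩ := q.mem_extSpace.1 hv
    rw [hH] at hvH
    have h3 := h _ h2 (hvH ▸ h1)
    rw [q.eq_mkVec v, hvH, h3, map_zero]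
    ext i
    simp [mkVec_apply]

/-- If the vectors `z` with `z` and `J z` in `U` are the multiples of `x` under `k(√d)`, then the
extension of `U` meets the `δ`-eigenspace of `J` in the line through `J x + δ x`. -/
lemma extSpace_inf_eq_span (hJ : ∀ x, J (J x) = q.d • x) {U : Submodule k (ι → k)}
    {H : Submodule L (ι → L)} (hH : ∀ v, v ∈ H ↔ q.reVec v = J (q.imVec v)) {x : ι → k}
    (hx : x ∈ U) (hJx : J x ∈ U) (hU : ∀ z ∈ U, J z ∈ U → ∃ a b, z = quadSMul J a b x) :
    extSpace L U ⊓ H = Submodule.span L {q.mkVec (J x) x} := by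
  apply le_antisymm
  · rintro v ⟨h1, h2⟩
    obtain ⟨h3, h4⟩ := q.mem_extSpace.1 h1
    have h5 := (hH v).1 h2
    obtain ⟨a, b, hab⟩ := hU _ h4 (h5 ▸ h3)
    refine Submodule.mem_span_singleton.2 ⟨algebraMap k L a + q.δ * algebraMap k L b, ?_⟩
    refine q.vec_ext ?_ ?_
    · rw [reVec_smul, reVec_mkVec, imVec_mkVec, q.re_mk, q.im_mk, h5, hab, map_quadSMul hJ,
        add_comm]
      rfl
    · rw [imVec_smul, reVec_mkVec, imVec_mkVec, q.re_mk, q.im_mk, hab]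
      rfl
  · rw [Submodule.span_singleton_le_iff_mem]
    exact ⟨q.mem_extSpace.2 (by simpa using ⟨hJx, hx⟩), (hH _).2 (by simp)⟩

lemma extSpace_inf_conj_eq_span (q : QuadraticPresentation σ) (U : Submodule k (ι → k))
    {H₁ H₂ : Submodule L (ι → L)} (hconj : IsConjugateBy σ H₁ H₂) {p : ι → L}
    (h : extSpace L U ⊓ H₁ = Submodule.span L {p}) :
    extSpace L U ⊓ H₂ = Submodule.span L {fun i => σ (p i)} := by
  have hext : ∀ v : ι → L, v ∈ extSpace L U ↔ (fun i => σ (v i)) ∈ extSpace L U := fun v => by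
    rw [q.mem_extSpace, q.mem_extSpace, reVec_conj, imVec_conj, Submodule.neg_mem_iff]
  ext v
  have h1 := hconj fun i => σ (v i)
  simp only [q.map_map] at h1
  rw [Submodule.mem_inf, hext v, ← h1, ← Submodule.mem_inf, h, Submodule.mem_span_singleton,
    Submodule.mem_span_singleton]
  constructor
  · rintro ⟨c, hc⟩
    refine ⟨σ c, funext fun i => ?_⟩
    have := congrArg σ (congrFun hc i)
    simpa [q.map_map] using this
  · rintro ⟨c, rfl⟩
    refine ⟨σ c, funext fun i => ?_⟩
    simp [q.map_map]

/-- The vector `thirdPoint F d J x` is the third point of `F = 0` on the line through the conjugate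
points `J x ± δ x`. -/
lemma isThirdIntersectionPoint [CharZero k] {F : MvPolynomial ι k} (hF3 : F.IsHomogeneous 3)
    (hJ : ∀ x, J (J x) = q.d • x) (hF : ∀ x, aeval (q.mkVec (J x) x) F = 0) {x : ι → k}
    (hx : x ≠ 0) (hx3 : eval (J x) F ^ 2 ≠ q.d * (q.d * eval x F) ^ 2) :
    IsThirdIntersectionPoint F (q.mkVec (J x) x) (fun i => σ (q.mkVec (J x) x i))
      (extVec L (thirdPoint F q.d J x)) := by
  have : CharZero L := charZero_of_injective_algebraMap (algebraMap k L).injective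
  have hδ := q.δ_ne_zero
  have hδ2 := q.δ_sq
  have hd : algebraMap k L q.d ≠ 0 := (map_ne_zero _).2 q.d_ne_zero
  set Y := extVec L x with hY
  set Y' := extVec L (J x) with hY'
  set A := algebraMap k L (eval x F) with hA
  set B := algebraMap k L (eval (J x) F) with hB
  have hAB : B ^ 2 ≠ algebraMap k L q.d * (algebraMap k L q.d * A) ^ 2 := by
    intro h
    refine hx3 ((algebraMap k L).injective ?_)
    simpa only [map_mul, map_pow] using h
  have hp : q.mkVec (J x) x = q.δ • Y + (1 : L) • Y' := by rw [one_smul, add_comm]; rfl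
  have hq : (fun i => σ (q.mkVec (J x) x i)) = (-q.δ) • Y + (1 : L) • Y' := by
    rw [conj_mkVec]
    ext i
    simp [mkVec_apply, hY, hY', extVec]
    ring
  have hr : extVec L (thirdPoint F q.d J x) = B • Y + (algebraMap k L q.d * A) • Y' := by
    ext i
    simp [thirdPoint, extVec, hY, hY', hA, hB, Algebra.smul_def]
  have hval : ∀ α β : L, aeval (α • Y + β • Y') F =
      (α - q.δ * β) * (α + q.δ * β) * (α * (algebraMap k L q.d * A) - β * B) / algebraMap k L q.d := by
    intro α β
    rw [q.aeval_pencil hF3 hF, ← hδ2, map_div₀, ← hδ2, ← hA, ← hB]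
    field_simp
    ring
  -- `x` and `J x` are linearly independent over `L`
  have hind : ∀ a b : L, a • Y + b • Y' = 0 → a = 0 ∧ b = 0 := by
    intro a b h
    have hre : ∀ (s : L) (z : ι → k), q.reVec (s • extVec L z) = q.re s • z ∧
        q.imVec (s • extVec L z) = q.im s • z := by
      intro s z
      have : extVec L z = q.mkVec z 0 := funext fun i => by simp [mkVec_apply, extVec]
      rw [reVec_smul, imVec_smul, this]
      simp
    have h1 := congrArg q.reVec h
    have h2 := congrArg q.imVec h
    rw [map_add, (hre _ _).1, (hre _ _).1, map_zero] at h1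
    rw [map_add, (hre _ _).2, (hre _ _).2, map_zero] at h2
    obtain ⟨a1, b1⟩ := q.quadSMul_eq_zero hJ hx h1
    obtain ⟨a2, b2⟩ := q.quadSMul_eq_zero hJ hx h2
    rw [q.eq_re_add_im a, q.eq_re_add_im b, a1, a2, b1, b2]
    simp
  have hline : ∀ a b α β : L, α • Y + β • Y' ∈ Submodule.span L {a • Y + b • Y'} ↔
      ∃ c, c * a = α ∧ c * b = β := by
    intro a b α β
    rw [Submodule.mem_span_singleton]
    refine exists_congr fun c => ?_
    constructor
    · intro h
      have := hind (c * a - α) (c * b - β) (by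
        rw [← sub_eq_zero.2 h]
        module)
      exact ⟨sub_eq_zero.1 this.1, sub_eq_zero.1 this.2⟩
    · rintro ⟨rfl, rfl⟩
      module
  have hlp : ∀ α β : L, α • Y + β • Y' ∈ Submodule.span L {q.δ • Y + (1 : L) • Y'} ↔
      α = q.δ * β := by
    intro α β
    rw [hline]
    constructor
    · rintro ⟨c, rfl, rfl⟩; ring
    · rintro rfl; exact ⟨β, by ring, by ring⟩
  have hlq : ∀ α β : L, α • Y + β • Y' ∈ Submodule.span L {(-q.δ) • Y + (1 : L) • Y'} ↔
      α = -(q.δ * β) := by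
    intro α β
    rw [hline]
    constructor
    · rintro ⟨c, rfl, rfl⟩; ring
    · rintro rfl; exact ⟨β, by ring, by ring⟩
  have hlr : ∀ α β : L, α • Y + β • Y' ∈
      Submodule.span L {B • Y + (algebraMap k L q.d * A) • Y'} ↔
      α * (algebraMap k L q.d * A) = β * B := by
    intro α β
    rw [hline]
    constructor
    · rintro ⟨c, rfl, rfl⟩; ring
    · intro h
      by_cases hB0 : B = 0
      · have hA0 : algebraMap k L q.d * A ≠ 0 := by
          intro hA0
          exact hAB (by rw [hA0, hB0]; ring)
        rw [hB0, mul_zero] at h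
        refine ⟨β / (algebraMap k L q.d * A), ?_, div_mul_cancel₀ _ hA0⟩
        rw [hB0, mul_zero, (mul_eq_zero.1 h).resolve_right hA0]
      · refine ⟨α / B, div_mul_cancel₀ _ hB0, ?_⟩
        rw [div_mul_eq_mul_div, h, mul_div_cancel_right₀ _ hB0]
  have hplane : ∀ y, y ∈ Submodule.span L {q.δ • Y + (1 : L) • Y', (-q.δ) • Y + (1 : L) • Y'} ↔
      ∃ α β : L, α • Y + β • Y' = y := by
    intro y
    rw [Submodule.mem_span_pair]
    constructor
    · rintro ⟨a, b, rfl⟩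
      exact ⟨(a - b) * q.δ, a + b, by module⟩
    · rintro ⟨α, β, rfl⟩
      refine ⟨(α / q.δ + β) / 2, (β - α / q.δ) / 2, ?_⟩
      have h1 : α = ((α / q.δ + β) / 2 - (β - α / q.δ) / 2) * q.δ := by field_simp; ring
      have h2 : β = (α / q.δ + β) / 2 + (β - α / q.δ) / 2 := by ring
      conv_rhs => rw [h1, h2]
      module
  rw [hq, hp, hr]
  refine ⟨?_, (hplane _).2 ⟨_, _, rfl⟩, ?_, ?_, ?_⟩
  · rw [LinearIndependent.pair_iff]
    intro a b h
    obtain ⟨h1, h2⟩ := hind ((a - b) * q.δ) (a + b) (by rw [← h]; module)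
    have h3 := (mul_eq_zero.1 h1).resolve_right hδ
    constructor
    · have : (2 : L) * a = 0 := by linear_combination h2 + h3
      exact (mul_eq_zero.1 this).resolve_left two_ne_zero
    · have : (2 : L) * b = 0 := by linear_combination h2 - h3
      exact (mul_eq_zero.1 this).resolve_left two_ne_zero
  · rw [hlp]
    intro h
    exact hAB (by rw [h, mul_pow, hδ2])
  · rw [hlq]
    intro h
    exact hAB (by rw [h, neg_sq, mul_pow, hδ2])
  · intro y hy
    obtain ⟨α, β, rfl⟩ := (hplane y).1 hy
    rw [hlp, hlq, hlr, hval, div_eq_zero_iff, or_iff_left hd, mul_eq_zero, mul_eq_zero,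
      sub_eq_zero, sub_eq_zero, ← eq_neg_iff_add_eq_zero, or_assoc]

/-- There is an `n`-dimensional `W ⊆ k^ι` with no nonzero `w ∈ W` such that `J w ∈ W`:
it is spanned by vectors that are linearly independent over `k(√d)`. -/
lemma exists_subspace [Fintype ι] {n : ℕ} {H : Submodule L (ι → L)}
    (hdim : Module.finrank L H = n + 1) (hH : ∀ v, v ∈ H ↔ q.reVec v = J (q.imVec v)) :
    ∃ W : Submodule k (ι → k), Module.finrank k W = n ∧ ∀ w ∈ W, J w ∈ W → w = 0 := by
  have him : ∀ v ∈ H, q.imVec v = 0 → v = 0 := by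
    intro v hv h
    have h1 := (hH v).1 hv
    rw [h, map_zero] at h1
    exact q.vec_ext (by rw [h1, map_zero]) (by rw [h, map_zero])
  let B : Module.Basis (Fin (n + 1)) L H := Module.finBasisOfFinrankEq L H hdim
  let h : Fin n → H := fun i => B i.castSucc
  have hBh : LinearIndependent L h := B.linearIndependent.comp _ (Fin.castSucc_injective n)
  let f : H →ₗ[k] (ι → k) := q.imVec ∘ₗ (H.subtype.restrictScalars k)
  have hf : ∀ v : H, f v = q.imVec (v : ι → L) := fun _ => rfl
  have hfinj : LinearMap.ker f = ⊥ :=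
    LinearMap.ker_eq_bot'.2 fun v hv => Subtype.ext (him v v.2 hv)
  have hli : LinearIndependent k (f ∘ h) := (hBh.restrict_scalars' k).map' f hfinj
  refine ⟨Submodule.span k (Set.range (f ∘ h)), ?_, ?_⟩
  · rw [finrank_span_eq_card hli, Fintype.card_fin]
  · intro w hw hJw
    obtain ⟨a, rfl⟩ := (Submodule.mem_span_range_iff_exists_fun k).1 hw
    obtain ⟨b, hb⟩ := (Submodule.mem_span_range_iff_exists_fun k).1 hJw
    have hsum : ∀ c : Fin n → k, ∑ i, c i • (f ∘ h) i = f (∑ i, c i • h i) := fun c => by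
      rw [map_sum]
      exact Finset.sum_congr rfl fun i _ => by rw [map_smul]; rfl
    rw [hsum] at hb ⊢
    rw [hsum] at hb
    set u := ∑ i, a i • h i with hu
    set v := ∑ i, b i • h i with hv
    -- `δ u` and `v` have the same second component `J w`, hence agree
    have h1 : q.δ • u = v := by
      rw [← sub_eq_zero]
      refine Subtype.ext (him _ (Subtype.mem _) ?_)
      rw [Submodule.coe_sub, Submodule.coe_smul, map_sub, imVec_smul, re_δ, im_δ,
        (hH u).1 u.2, zero_smul, zero_add, one_smul, ← hf u, ← hf v, hb, sub_self]
    have h2 : ∑ i, (algebraMap k L (-b i) + q.δ * algebraMap k L (a i)) • h i = 0 := by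
      rw [← sub_eq_zero.2 h1, hu, hv, Finset.smul_sum, ← Finset.sum_sub_distrib]
      refine Finset.sum_congr rfl fun i _ => ?_
      rw [add_smul, mul_smul, algebraMap_smul, algebraMap_smul, neg_smul, add_comm, sub_eq_add_neg]
    have h3 := Fintype.linearIndependent_iff.1 hBh _ h2
    have h4 : u = 0 := by
      rw [hu]
      refine Finset.sum_eq_zero fun i _ => ?_
      rw [(q.eq_zero_of_add_eq_zero (h3 i)).2, zero_smul]
    rw [h4, map_zero]

end QuadraticPresentation

lemma exists_complement_basis {k ι : Type*} [Field k] [Fintype ι] {n : ℕ}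
    (hι : Fintype.card ι = 2 * n + 2) {W : Submodule k (ι → k)} (hW : Module.finrank k W = n) :
    ∃ e : Fin 2 ⊕ Fin n → (ι → k), LinearIndependent k e ∧
      IsCompl W (Submodule.span k (Set.range e)) := by
  obtain ⟨U, hU⟩ := Submodule.exists_isCompl W
  have h := Submodule.finrank_add_eq_of_isCompl hU
  rw [hW, Module.finrank_fintype_fun_eq_card, hι] at h
  let b : Module.Basis (Fin 2 ⊕ Fin n) k U :=
    (Module.finBasisOfFinrankEq k U (n := 2 + n) (by omega)).reindex finSumFinEquiv.symm
  refine ⟨fun c => (b c : ι → k), b.linearIndependent.map' U.subtype U.ker_subtype, ?_⟩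
  have : Submodule.span k (Set.range fun c => (b c : ι → k)) = U := by
    have h1 : (Set.range fun c => (b c : ι → k)) = U.subtype '' Set.range b := by
      rw [← Set.range_comp]; rfl
    rw [h1, Submodule.span_image, b.span_eq, Submodule.map_top, Submodule.range_subtype]
  rwa [this]

/-! ### Fermat cubics -/

section Fermat

variable {k : Type*} [Field k]

/-- Multiplication by `√-3` in the coordinates `s = x + y`, `r = x - y` on each pair of variables,
where `x³ + y³ = s (s² + 3 r²) / 4` is a multiple of the trace of `z² z̄` for `z = s + r √-3`. The
equivalence `ε` arranges the variables in pairs `ε (inl i)`, `ε (inr i)`. -/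
def fermatOperator (k : Type*) [Field k] {κ ι : Type*} (ε : κ ⊕ κ ≃ ι) :
    (ι → k) →ₗ[k] (ι → k) where
  toFun x j := Sum.elim (fun i => 2 * x (ε (Sum.inr i)) - x (ε (Sum.inl i)))
    (fun i => x (ε (Sum.inr i)) - 2 * x (ε (Sum.inl i))) (ε.symm j)
  map_add' x y := by
    ext j
    obtain ⟨i | i, rfl⟩ := ε.surjective j <;> simp <;> ring
  map_smul' c x := by
    ext j
    obtain ⟨i | i, rfl⟩ := ε.surjective j <;> simp <;> ring

lemma isHomogeneous_fermat {ι : Type*} [Fintype ι] :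
    (∑ i, X i ^ 3 : MvPolynomial ι k).IsHomogeneous 3 :=
  IsHomogeneous.sum _ _ _ fun i _ => isHomogeneous_X_pow i 3

lemma isSmoothHypersurface_fermat [CharZero k] {ι : Type*} [Fintype ι] :
    IsSmoothHypersurface (∑ i, X i ^ 3 : MvPolynomial ι k) := by
  classical
  intro v hv _
  obtain ⟨i, hi⟩ := Function.ne_iff.1 hv
  refine ⟨i, ?_⟩
  have : CharZero (AlgebraicClosure k) :=
    charZero_of_injective_algebraMap (algebraMap k (AlgebraicClosure k)).injective
  have h : pderiv i (∑ i, X i ^ 3 : MvPolynomial ι k) = 3 * X i ^ 2 := by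
    rw [map_sum, Finset.sum_eq_single i]
    · rw [pderiv_pow, pderiv_X_self]; norm_num
    · intro j _ hj
      rw [pderiv_pow, pderiv_X_of_ne hj, mul_zero]
    · simp
  rw [h]
  simpa using hi

variable (k) in
/-- The Fermat cubic in an even number of variables is rational: up to scaling by `k(√-3)` its
points are parametrized by the vectors whose first pair of coordinates is `z₀ = 1`. The algebra
`k(√-3)` enters only through `fermatOperator`, so it does not matter whether `-3` is a square. -/
theorem isRationalHypersurface_fermat [CharZero k] {ι : Type*} [Fintype ι] [DecidableEq ι] {n : ℕ}
    (hn : 1 ≤ n) (ε : Fin (n + 1) ⊕ Fin (n + 1) ≃ ι) :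
    IsRationalHypersurface (2 * n)
      (∑ i, X i ^ 3 : MvPolynomial ι k) := by
  set F : MvPolynomial ι k := ∑ i, X i ^ 3 with hFdef
  have hF3 : F.IsHomogeneous 3 := isHomogeneous_fermat
  let J : (ι → k) →ₗ[k] (ι → k) := fermatOperator k ε
  have hJl : ∀ x i, J x (ε (Sum.inl i)) = 2 * x (ε (Sum.inr i)) - x (ε (Sum.inl i)) := fun _ _ => by
    simp [J, fermatOperator]
  have hJr : ∀ x i, J x (ε (Sum.inr i)) = x (ε (Sum.inr i)) - 2 * x (ε (Sum.inl i)) := fun _ _ => by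
    simp [J, fermatOperator]
  have hJ : ∀ x, J (J x) = (-3 : k) • x := by
    intro x
    ext j
    obtain ⟨i | i, rfl⟩ := ε.surjective j <;> simp only [hJl, hJr, Pi.smul_apply, smul_eq_mul] <;> ring
  have hFx : ∀ x, eval x F = ∑ i : Fin (n + 1), (x (ε (Sum.inl i)) ^ 3 + x (ε (Sum.inr i)) ^ 3) := by
    intro x
    rw [hFdef, map_sum, ← ε.sum_comp]
    simp [Finset.sum_add_distrib]
  have hFJ : ∀ a b x, eval (quadSMul J a b x) F =
      (a ^ 2 - -3 * b ^ 2) * (a * eval x F - b * eval (J x) F / -3) := by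
    intro a b x
    rw [hFx, hFx, hFx, Finset.mul_sum, Finset.mul_sum, Finset.sum_div, ← Finset.sum_sub_distrib,
      Finset.mul_sum]
    refine Finset.sum_congr rfl fun i _ => ?_
    simp only [quadSMul, Pi.add_apply, Pi.smul_apply, smul_eq_mul, hJl, hJr]
    ring
  have hE : compForm F J ∉ Ideal.span {F} := by
    intro h
    obtain ⟨c, hc⟩ := exists_eq_C_mul_of_mem_span hF3 (isHomogeneous_compForm hF3 J) h
    -- compare both sides at a vector with a single pair of nonzero coordinates
    have hval : ∀ a b : k, (2 * b - a) ^ 3 + (b - 2 * a) ^ 3 = c * (a ^ 3 + b ^ 3) := by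
      intro a b
      have h1 := congrArg (eval (fun j => Sum.elim (Pi.single 0 a) (Pi.single 0 b) (ε.symm j))) hc
      rw [eval_compForm, map_mul, eval_C, hFx, hFx] at h1
      rw [Finset.sum_eq_single 0, Finset.sum_eq_single 0] at h1
      · simpa [hJl, hJr] using h1
      · intro i _ hi; simp [hi]
      · simp
      · intro i _ hi; simp [hJl, hJr, hi]
      · simp
    have h1 := hval 1 0
    have h2 := hval 1 1
    have h3 : (18 : k) = 0 := by linear_combination -2 * h1 + h2
    norm_num at h3
  let s : Fin (n + 1) → (ι → k) →ₗ[k] k := fun i =>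
    LinearMap.proj (R := k) (φ := fun _ => k) (ε (Sum.inl i)) + LinearMap.proj (ε (Sum.inr i))
  let r : Fin (n + 1) → (ι → k) →ₗ[k] k := fun i =>
    LinearMap.proj (R := k) (φ := fun _ => k) (ε (Sum.inl i)) - LinearMap.proj (ε (Sum.inr i))
  have hs : ∀ i x, s i x = x (ε (Sum.inl i)) + x (ε (Sum.inr i)) := fun _ _ => rfl
  have hr : ∀ i x, r i x = x (ε (Sum.inl i)) - x (ε (Sum.inr i)) := fun _ _ => rfl
  let P : ι → MvPolynomial (Fin 2 × Fin n) k := fun j => Sum.elim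
    (Fin.cons 1 fun i => X (0, i) + X (1, i)) (Fin.cons 1 fun i => X (0, i) - X (1, i)) (ε.symm j)
  let D : MvPolynomial ι k := wedgeForm J (s 0) (r 0)
  let Q : Fin 2 × Fin n → MvPolynomial ι k := fun ji =>
    if ji.1 = 0 then wedgeForm J (s ji.2.succ) (r 0) else wedgeForm J (r ji.2.succ) (r 0)
  have hQ0 : ∀ i, Q (0, i) = wedgeForm J (s i.succ) (r 0) := fun i => rfl
  have hQ1 : ∀ i, Q (1, i) = wedgeForm J (r i.succ) (r 0) := fun i => rfl
  have hDx : ∀ x, eval x D = s 0 x ^ 2 + 3 * r 0 x ^ 2 := by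
    intro x
    simp only [D, eval_wedgeForm, hs, hr, hJl, hJr]
    ring
  have hD0 : D ≠ 0 := by
    intro h
    have h1 := hDx 1
    rw [h, map_zero, hs, hr] at h1
    norm_num at h1
  have hprime : (Ideal.span {F}).IsPrime :=
    isPrime_span_of_isSmoothHypersurface (by
      rw [← Fintype.card_congr ε]; simp; omega) hF3 isSmoothHypersurface_fermat
  have hbir : IsBirationalParametrization F (thirdPointPoly F (-3) J P) := by
    refine isBirationalParametrization_thirdPointPoly hF3 hprime (by norm_num) hJ hFJ hE P D Q
      (isHomogeneous_wedgeForm _ _) hD0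
      (forall_fin_two_prod (fun i => isHomogeneous_wedgeForm _ _) fun i => isHomogeneous_wedgeForm _ _)
      (fun a b x => eval_wedgeForm_quadSMul hJ _ _ a b x)
      (forall_fin_two_prod (fun i a b x => eval_wedgeForm_quadSMul hJ _ _ a b x)
        fun i a b x => eval_wedgeForm_quadSMul hJ _ _ a b x) ?_ 1 one_ne_zero ?_
    · intro t
      rw [hDx]
      refine forall_fin_two_prod (fun i => ?_) fun i => ?_
      · rw [hQ0, eval_wedgeForm]
        simp [hs, hr, hJl, hJr, P]
        ring
      · rw [hQ1, eval_wedgeForm]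
        simp [hs, hr, hJl, hJr, P]
        ring
    · -- multiplication by `2 / z₀` turns `x` into a vector with first pair of coordinates `1, 1`
      intro x hD _
      set Δ := eval x D
      have hΔ : Δ = s 0 x ^ 2 + 3 * r 0 x ^ 2 := hDx x
      refine ⟨fun j => eval x (Q j) / Δ, 2 * s 0 x / Δ, -2 * r 0 x / Δ, ?_, ?_⟩
      · have : (2 * s 0 x / Δ) ^ 2 - -3 * (-2 * r 0 x / Δ) ^ 2 =
            4 * (s 0 x ^ 2 + 3 * r 0 x ^ 2) / Δ ^ 2 := by ring
        rw [this, ← hΔ]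
        exact div_ne_zero (mul_ne_zero (by norm_num) hD) (pow_ne_zero _ hD)
      · ext j
        obtain ⟨i | i, rfl⟩ := ε.surjective j <;> refine Fin.cases ?_ (fun i => ?_) i
        · simp only [P, quadSMul, Equiv.symm_apply_apply, Sum.elim_inl, Fin.cons_zero, map_one, Pi.add_apply,
            Pi.smul_apply, smul_eq_mul, hJl]
          field_simp
          rw [hΔ, hs, hr]
          ring
        · simp only [P, quadSMul, Equiv.symm_apply_apply, Sum.elim_inl, Fin.cons_succ, map_add, eval_X, Pi.add_apply,
            Pi.smul_apply, smul_eq_mul, hJl, hQ0, hQ1, eval_wedgeForm]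
          field_simp
          simp only [hs, hr, hJl, hJr]
          ring
        · simp only [P, quadSMul, Equiv.symm_apply_apply, Sum.elim_inr, Fin.cons_zero, map_one, Pi.add_apply,
            Pi.smul_apply, smul_eq_mul, hJr]
          field_simp
          rw [hΔ, hs, hr]
          ring
        · simp only [P, quadSMul, Equiv.symm_apply_apply, Sum.elim_inr, Fin.cons_succ, map_sub, eval_X, Pi.add_apply,
            Pi.smul_apply, smul_eq_mul, hJr, hQ0, hQ1, eval_wedgeForm]
          field_simp
          simp only [hs, hr, hJl, hJr]
          ring
  exact hbir.isRationalHypersurface finProdFinEquiv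

end Fermat

/-! ### Smooth cubics with two conjugate `n`-planes -/

/-- The third intersection points of the lines cut out by the `(n + 1)`-planes through `ℙ(W)` give a
birational parametrization in every standard chart of the Grassmannian of these planes. -/
theorem exists_birational_thirdPoint_chart {k L : Type*} [Field k] [CharZero k] [Field L]
    [Algebra k L] {σ : L ≃ₐ[k] L} (q : QuadraticPresentation σ) {n : ℕ} {ι : Type*} [Fintype ι]
    [DecidableEq ι] (hι : Fintype.card ι = 2 * n + 2) {F : MvPolynomial ι k}
    (hF3 : F.IsHomogeneous 3) (hF : (Ideal.span {F}).IsPrime) (hF0 : F ≠ 0)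
    {H₁ H₂ : Submodule L (ι → L)} (hconj : IsConjugateBy σ H₁ H₂)
    (hFH : ContainedInHypersurface F H₁) {J : (ι → k) →ₗ[k] (ι → k)} (hJ : ∀ x, J (J x) = q.d • x)
    (hH₁ : ∀ v, v ∈ H₁ ↔ q.reVec v = J (q.imVec v)) {W : Submodule k (ι → k)}
    (hW : Disjoint (extSpace L W) H₁) {e : Fin 2 ⊕ Fin n → (ι → k)} (he : LinearIndependent k e)
    (hWe : IsCompl W (Submodule.span k (Set.range e))) :
    ∃ φ : ι → MvPolynomial (Fin 2 × Fin n) k,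
      IsBirationalParametrization F φ ∧
      ∃ g : MvPolynomial (Fin 2 × Fin n) k, g ≠ 0 ∧
        ∀ t : Fin 2 × Fin n → k, eval t g ≠ 0 →
          ∃ p : ι → L,
            extSpace L (chartPlane W e t) ⊓ H₁ = Submodule.span L {p} ∧
            extSpace L (chartPlane W e t) ⊓ H₂ = Submodule.span L {fun i => σ (p i)} ∧
            IsThirdIntersectionPoint F p (fun i => σ (p i)) (extVec L fun i => eval t (φ i)) := by
  have hFJ : ∀ x, aeval (q.mkVec (J x) x) F = 0 := fun x => hFH _ ((hH₁ _).2 (by simp))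
  obtain ⟨pr, hprW, hpre⟩ := exists_coordinates he hWe
  obtain ⟨P, hbir, g, hg0, hg⟩ := exists_chart_parametrization hF3 hF hF0 q.sq_ne_d hJ
    (q.eval_quadSMul hF3 hFJ) hι (fun y => ⟨_, hpre y⟩) fun x hx hJx =>
      (q.disjoint_extSpace_iff hH₁).1 hW x ((hprW x).1 hx) ((hprW _).1 hJx)
  refine ⟨_, hbir, g, hg0, fun t ht => ?_⟩
  obtain ⟨hx0, hx3, hx, hJx, huniq⟩ := hg t ht _ rfl
  rw [eval_thirdPointPoly]
  set x : ι → k := fun i => eval t (P i)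
  have hch := mem_chartPlane_iff hprW hpre t
  have h1 := q.extSpace_inf_eq_span hJ hH₁ ((hch x).2 hx) ((hch _).2 hJx)
    fun z hz hJz => huniq z ((hch z).1 hz) ((hch _).1 hJz)
  exact ⟨_, h1, q.extSpace_inf_conj_eq_span _ hconj h1,
    q.isThirdIntersectionPoint hF3 hJ hFJ hx0 hx3⟩

theorem proposition3p3 {k : Type*} [Field k] [CharZero k] (n : ℕ) (hn : 1 ≤ n) :
    -- smooth cubics with two skew conjugate `n`-planes `ℙ(H₁)`, `ℙ(H₂)`
    (∀ F : MvPolynomial (Fin (2 * n + 2)) k, F.IsHomogeneous 3 → IsSmoothHypersurface F →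
      ∀ (L : Type*) [Field L] [Algebra k L] (σ : L ≃ₐ[k] L)
        (H₁ H₂ : Submodule L (Fin (2 * n + 2) → L)),
        Module.finrank k L = 2 → σ ≠ AlgEquiv.refl →
        Module.finrank L H₁ = n + 1 → IsConjugateBy σ H₁ H₂ → Disjoint H₁ H₂ →
        ContainedInHypersurface F H₁ → ContainedInHypersurface F H₂ →
        IsRationalHypersurface (2 * n) F ∧
        -- there is an `(n - 1)`-plane `Λ = ℙ(W)` over `k` that meets neither of the two `n`-planes
        (∃ W : Submodule k (Fin (2 * n + 2) → k), Module.finrank k W = n ∧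
          Disjoint (extSpace L W) H₁ ∧ Disjoint (extSpace L W) H₂) ∧
        -- for any such `Λ`, and in any standard chart of the Grassmannian of the
        -- `(n + 1)`-planes through `Λ`, the third intersection point is a birational map to `X`
        (∀ W : Submodule k (Fin (2 * n + 2) → k), Module.finrank k W = n →
          Disjoint (extSpace L W) H₁ → Disjoint (extSpace L W) H₂ →
          ∀ e : Fin 2 ⊕ Fin n → (Fin (2 * n + 2) → k), LinearIndependent k e →
            IsCompl W (Submodule.span k (Set.range e)) →
            ∃ φ : Fin (2 * n + 2) → MvPolynomial (Fin 2 × Fin n) k,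
              IsBirationalParametrization F φ ∧
              ∃ g : MvPolynomial (Fin 2 × Fin n) k, g ≠ 0 ∧
                ∀ t : Fin 2 × Fin n → k, eval t g ≠ 0 →
                  ∃ p : Fin (2 * n + 2) → L,
                    extSpace L (chartPlane W e t) ⊓ H₁ = Submodule.span L {p} ∧
                    extSpace L (chartPlane W e t) ⊓ H₂ =
                      Submodule.span L {fun i => σ (p i)} ∧
                    IsThirdIntersectionPoint F p (fun i => σ (p i))
                      (extVec L fun i => eval t (φ i)))) ∧
    -- even-dimensional Fermat cubics
    IsRationalHypersurface (2 * n)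
      (∑ i : Fin (2 * n + 2), (X i : MvPolynomial (Fin (2 * n + 2)) k) ^ 3) := by
  refine ⟨?_, isRationalHypersurface_fermat k hn (finSumFinEquiv.trans (finCongr (by ring)))⟩
  intro F hF3 hFs L _ _ σ H₁ H₂ hL hσ hH₁ hconj hdisj hFH _
  have hι : Fintype.card (Fin (2 * n + 2)) = 2 * n + 2 := Fintype.card_fin _
  obtain ⟨q⟩ := nonempty_quadraticPresentation hL hσ
  obtain ⟨J, hJ, hJ₁, hJ₂⟩ := q.exists_operator hL hι hH₁ hconj hdisj
  have hF := isPrime_span_of_isSmoothHypersurface (by rw [hι]; omega) hF3 hFs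
  have hF0 : F ≠ 0 := hFs.ne_zero
  obtain ⟨W, hW, hJW⟩ := q.exists_subspace hH₁ hJ₁
  have hW₁ := (q.disjoint_extSpace_iff hJ₁).2 hJW
  have hW₂ : Disjoint (extSpace L W) H₂ :=
    (q.disjoint_extSpace_iff (J := -J) hJ₂).2 fun w hw hJw => hJW w hw (by simpa using hJw)
  have hchart := fun (W : Submodule k (Fin (2 * n + 2) → k)) (hW : Disjoint (extSpace L W) H₁)
    (e : Fin 2 ⊕ Fin n → (Fin (2 * n + 2) → k)) (he : LinearIndependent k e)
    (hWe : IsCompl W (Submodule.span k (Set.range e))) =>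
      exists_birational_thirdPoint_chart q hι hF3 hF hF0 hconj hFH hJ hJ₁ hW he hWe
  refine ⟨?_, ⟨W, hW, hW₁, hW₂⟩, fun W _ hW _ e he hWe => hchart W hW e he hWe⟩
  obtain ⟨e, he, hWe⟩ := exists_complement_basis hι hW
  obtain ⟨φ, hφ, -⟩ := hchart W hW₁ e he hWe
  exact hφ.isRationalHypersurface finProdFinEquiv
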